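/- **Setting.** Let $0<d<l$, $\Delta=[-l,-d]\cup[d,l]$, $p,m\ge 1$, $m=r+s$, $H=L^2(\Delta;\mathbb C^p)$. Elements of $\mathbb C^p,\mathbb C^m,\mathbb C^{2m}$ are row vectors and matrices act on them from the right. Let $J_1=\mathrm{diag}(I_r,0)$, $J_2=\mathrm{diag}(0,I_{s})$, $S_0=\begin{pmatrix}0&0\\ \widehat S&0\end{pmatrix}$, $L=J_1-J_2+S_0+S_0^*$, and let $\Pi$ be a measurable $p\times m$ matrix function on $\Delta$, with linearly independent rows at each point of a set of positive measure, such that $\widetilde\Pi=\Pi^*\Pi$ satisfies $\operatorname{tr}\widetilde\Pi=1$, $\widetilde\Pi J_1=J_1\widetilde\Pi$ and is Hölder continuous on $\Delta$ with an exponent in $(0,1]$. Let $B$ on $H$ be the triangular model of a coupling of a dissipative and an antidissipative operator, $$Bf(w)=wf(w)-i\!\int_{-l}^w\! f\chi_\Delta\Pi\, S_0^*\,\Pi^*(w)\,d\xi+i\!\int_w^l\! f\chi_\Delta\Pi\, S_0\,\Pi^*(w)\,d\xi+i\!\int_{-l}^w\! f\chi_\Delta\Pi\, L\,\Pi^*(w)\,d\xi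 .$$ Assume that $B$ is invertible and that $B^*=-UBU^*$ for a unitary $U$ on $H$. Put $A=B^{-1}$, $\Phi f=\int_\Delta f(w)\Pi(w)\,dw$, $\widetilde\Phi f=(\Phi f,\ \Phi (B^{-1})^*f)\in\mathbb C^{2m}$, $$\sigma_A=\begin{pmatrix}0&0\\0&-L\end{pmatrix},\quad \sigma_B=\begin{pmatrix}L&0\\0&0\end{pmatrix},\quad \gamma=\begin{pmatrix}0&-L\\-L&0\end{pmatrix},\quad \widetilde\gamma=\gamma+i(\sigma_A\widetilde\Phi\widetilde\Phi^*\sigma_B-\sigma_B\widetilde\Phi\widetilde\Phi^*\sigma_A),$$ $$T(x,t)=e^{i(-tA+xB)},\qquad T^{*-1}(x,t)=e^{i(-tA^*+xB^*)} .$$ Let $\rho,N,M_1,M,\widetilde B$ be bounded operators on $H$ with $$NB=BN,\quad N\widetilde B=N,\quad M\widetilde B=-M,\quad \widetilde B^2=I,\quad M_1=U^*,\quad M=\int_0^\infty e^{-ixB^*}\rho\,\tfrac{B-B^*}{i}\,e^{ixB}\,dx ,$$ the integral being a strong limit of $\int_0^R$ as $R\to\infty$. Put $\widetilde\rho=U^*\rho$,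 $P_1=\frac12(I+\widetilde B)$, $\Gamma(x,t)=T(x,t)N+M_1T^{*-1}(x,t)M$, $S(x,t)=\Gamma^{-1}(x,t)\Gamma_x(x,t)$ where $\Gamma$ is invertible, $v_h(\xi)=\widetilde\Phi e^{i\xi B}h$ (the mode of $h\in H$), and, for a bounded operator $\tau$ on $H$, $$\Psi_\tau(x,t)=\widetilde\Phi T(x,t)\,\tau\,\widetilde\Phi^*\sigma_B=\widetilde\Phi e^{i(-tA+xB)}\,\tau\,\widetilde\Phi^*\sigma_B,\qquad \Psi=\Psi_{\widetilde\rho}.$$ **Theorem.** (a) $(A=B^{-1},B;H,\widetilde\Phi,\mathbb C^{2m};\sigma_A,\sigma_B,\gamma,\widetilde\gamma)$ is a commutative regular colligation: $AB=BA$, $\sigma_A,\sigma_B,\gamma,\widetilde\gamma$ are selfadjoint, $(A-A^*)/i=\widetilde\Phi^*\sigma_A\widetilde\Phi$, $(B-B^*)/i=\widetilde\Phi^*\sigma_B\widetilde\Phi$, $\sigma_A\widetilde\Phi B^*-\sigma_B\widetilde\Phi A^*=\gamma\widetilde\Phi$, $\sigma_A\widetilde\Phi B-\sigma_B\widetilde\Phi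 A=\widetilde\gamma\widetilde\Phi$. (b) At every $(x,t)\in\mathbb R^2$ where $\Gamma(x,t)$ is invertible, $S(x,t)$ is invertible and satisfies the Sine-Gordon equation $$\frac{\partial}{\partial t}\Big(S^{-1}\frac{\partial}{\partial x}S\Big)=\widetilde BS^{-1}\widetilde BS-S^{-1}\widetilde BS\widetilde B .$$ (c) At every such $(x,t)$, for every $g\in G_B=(B-B^*)H$, put $h=h(x,t)=S(x,t)g-iBg$. Then for all $\xi\in\mathbb R$ $$v_{Nh}(\xi)=-\int_0^\infty\Psi(-2x+\xi+\eta,-2t)\,v_h(\eta)\,d\eta+\Psi(-2x+\xi,-2t)\,v_g(0);$$ in particular, in the normalization $N=P_1$, $$v_{P_1h}(\xi)=-\int_0^\infty\Psi(-2x+\xi+\eta,-2t)\,v_h(\eta)\,d\eta+\Psi(-2x+\xi,-2t)\,v_g(0).$$ More generally, if $N=\widehat NP_1$ with $\widehat N$ invertible and commuting with $B$, then the last equation holds with $\Psi=\Psi_{\widetilde\rho}$ replaced by $\Psi_{\widehat N^{-1}\widetilde\rho}$. All integrals $\int_0^\infty$ converge as limits of $\int_0^R$, $R\to\infty$. -/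

import Mathlib

open MeasureTheory Filter Topology ContinuousLinearMap
open scoped Matrix InnerProductSpace

noncomputable section

namespace SolitonGLM

/-! ### Matrices acting on row vectors from the right -/

/-- The operator `v ↦ v X` on row vectors, between the unitary spaces `ℂ^α` and `ℂ^β`. -/
def rowMul {α β : Type} [Fintype α] [Fintype β] (X : Matrix α β ℂ) :
    EuclideanSpace ℂ α →L[ℂ] EuclideanSpace ℂ β :=
  LinearMap.toContinuousLinearMap
    { toFun := fun v => WithLp.toLp 2 (v.ofLp ᵥ* X)
      map_add' := fun v w => by ext j; simp [Matrix.add_vecMul]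
      map_smul' := fun c v => by ext j; simp [Matrix.smul_vecMul] }

theorem rowMul_apply {α β : Type} [Fintype α] [Fintype β] (X : Matrix α β ℂ)
    (v : EuclideanSpace ℂ α) : rowMul X v = WithLp.toLp 2 (v.ofLp ᵥ* X) := rfl

theorem norm_rowMul_le {α β : Type} [Fintype α] [Fintype β] (X : Matrix α β ℂ) (K : ℝ)
    (hX : ∀ i j, ‖X i j‖ ≤ K) (v : EuclideanSpace ℂ α) :
    ‖rowMul X v‖ ≤ (Fintype.card β * (Fintype.card α * K)) * ‖v‖ := by
  classical
  have h1 : ‖rowMul X v‖ ≤ ∑ j, ‖(rowMul X v) j‖ := by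
    conv_lhs => rw [← (EuclideanSpace.basisFun β ℂ).sum_repr (rowMul X v)]
    refine (norm_sum_le _ _).trans (Finset.sum_le_sum fun j _ => ?_)
    simp [norm_smul]
  refine h1.trans ?_
  have h2 : ∀ j, ‖(rowMul X v) j‖ ≤ Fintype.card α * K * ‖v‖ := by
    intro j
    have : (rowMul X v) j = ∑ i, v i * X i j := by
      simp [rowMul_apply, Matrix.vecMul, dotProduct]
    rw [this]
    refine (norm_sum_le _ _).trans ?_
    have : ∀ i ∈ Finset.univ, ‖v i * X i j‖ ≤ K * ‖v‖ := by
      intro i _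
      rw [norm_mul, mul_comm]
      exact mul_le_mul (hX i j) (PiLp.norm_apply_le v i) (norm_nonneg _)
        ((norm_nonneg _).trans (hX i j))
    refine (Finset.sum_le_sum this).trans ?_
    simp [mul_assoc]
  refine (Finset.sum_le_sum fun j _ => h2 j).trans ?_
  simp [mul_assoc]

theorem aestronglyMeasurable_rowMul {α β : Type} [Fintype α] [Fintype β] {μ : Measure ℝ}
    {X : ℝ → Matrix α β ℂ} {v : ℝ → EuclideanSpace ℂ α}
    (hX : ∀ i j, AEMeasurable (fun w => X w i j) μ) (hv : AEStronglyMeasurable v μ) :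
    AEStronglyMeasurable (fun w => rowMul (X w) (v w)) μ := by
  refine (PiLp.continuous_toLp 2 _).comp_aestronglyMeasurable
    (g := fun x : β → ℂ => (WithLp.toLp 2 x : EuclideanSpace ℂ β))
    (f := fun w => (v w).ofLp ᵥ* X w) ?_
  refine (aemeasurable_pi_lambda _ fun j => ?_).aestronglyMeasurable
  simp only [Matrix.vecMul, dotProduct]
  refine Finset.aemeasurable_fun_sum _ fun i _ => AEMeasurable.mul ?_ (hX i j)
  exact ((EuclideanSpace.proj (𝕜 := ℂ) i).continuous.comp_aestronglyMeasurable hv).aemeasurable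

/-! ### The triangular model on `L²([-l,-d] ∪ [d,l]; ℂ^p)` -/

/-- `Δ = [-l,-d] ∪ [d,l]`. -/
def Delta (l d : ℝ) : Set ℝ := Set.Icc (-l) (-d) ∪ Set.Icc d l

theorem measurableSet_Delta (l d : ℝ) : MeasurableSet (Delta l d) :=
  measurableSet_Icc.union measurableSet_Icc

/-- Lebesgue measure on `Δ`. -/
def muDelta (l d : ℝ) : Measure ℝ := volume.restrict (Delta l d)

instance (l d : ℝ) : IsFiniteMeasure (muDelta l d) := by
  refine ⟨?_⟩
  rw [muDelta, Measure.restrict_apply_univ, Delta]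
  refine (measure_union_le _ _).trans_lt ?_
  simp

/-- The Hilbert space `L²(Δ; ℂ^p)`. -/
abbrev HSpace (l d : ℝ) (p : ℕ) : Type := Lp (EuclideanSpace ℂ (Fin p)) 2 (muDelta l d)

/-- The signature matrix `J₁ = diag(I_r, 0)`; here `m = r + s`. -/
def J₁ (r s : ℕ) : Matrix (Fin r ⊕ Fin s) (Fin r ⊕ Fin s) ℂ := Matrix.fromBlocks 1 0 0 0

/-- The signature matrix `J₂ = diag(0, I_{m-r})`. -/
def J₂ (r s : ℕ) : Matrix (Fin r ⊕ Fin s) (Fin r ⊕ Fin s) ℂ := Matrix.fromBlocks 0 0 0 1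

/-- The data of a triangular model on `Δ` with `m = r + s` channels: the off-diagonal block of
`S` and the `p × m` matrix function `Π`. -/
structure ModelData (l d : ℝ) (p r s : ℕ) where
  /-- the lower left block `Ŝ` of `S` -/
  Shat : Matrix (Fin s) (Fin r) ℂ
  /-- the matrix function `Π` -/
  P : ℝ → Matrix (Fin p) (Fin r ⊕ Fin s) ℂ
  measurable_P : ∀ i j, AEMeasurable (fun w => P w i j) (muDelta l d)
  /-- the rows of `Π(w)` are linearly independent on a set of positive measure -/
  rows_indep : ∃ F : Set ℝ, F ⊆ Delta l d ∧ MeasurableSet F ∧ 0 < volume F ∧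
    ∀ w ∈ F, LinearIndependent ℂ (fun i => P w i)
  trace_eq_one : ∀ w ∈ Delta l d, ((P w)ᴴ * P w).trace = 1
  commute_J₁ : ∀ w ∈ Delta l d, ((P w)ᴴ * P w) * J₁ r s = J₁ r s * ((P w)ᴴ * P w)
  /-- `Π*Π` is Hölder continuous on `Δ` -/
  holder : ∃ C > 0, ∃ a : ℝ, 0 < a ∧ a ≤ 1 ∧ ∀ w₁ ∈ Delta l d, ∀ w₂ ∈ Delta l d, ∀ i j,
    ‖((P w₁)ᴴ * P w₁) i j - ((P w₂)ᴴ * P w₂) i j‖ ≤ C * |w₁ - w₂| ^ a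

variable {l d : ℝ} {p r s : ℕ}

namespace ModelData

/-- `S = [[0, 0], [Ŝ, 0]]`. -/
def S (D : ModelData l d p r s) : Matrix (Fin r ⊕ Fin s) (Fin r ⊕ Fin s) ℂ :=
  Matrix.fromBlocks 0 0 D.Shat 0

/-- `L = J₁ - J₂ + S + S*`. -/
def L (D : ModelData l d p r s) : Matrix (Fin r ⊕ Fin s) (Fin r ⊕ Fin s) ℂ :=
  J₁ r s - J₂ r s + D.S + D.Sᴴ

theorem norm_P_le (D : ModelData l d p r s) {w : ℝ} (hw : w ∈ Delta l d) (i j) :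
    ‖D.P w i j‖ ≤ 1 := by
  have h := D.trace_eq_one w hw
  have h2 : ((D.P w)ᴴ * D.P w).trace = ((∑ b, ∑ a, ‖D.P w a b‖ ^ 2 : ℝ) : ℂ) := by
    simp only [Matrix.trace, Matrix.diag, Matrix.mul_apply, Matrix.conjTranspose_apply]
    push_cast
    refine Finset.sum_congr rfl fun b _ => Finset.sum_congr rfl fun a _ => ?_
    rw [RCLike.star_def, RCLike.conj_mul]
    simp
  rw [h2] at h
  have h3 : (∑ b, ∑ a, ‖D.P w a b‖ ^ 2 : ℝ) = 1 := by exact_mod_cast h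
  have h4 : ‖D.P w i j‖ ^ 2 ≤ 1 := by
    rw [← h3]
    refine le_trans ?_ (Finset.single_le_sum (f := fun b => ∑ a, ‖D.P w a b‖ ^ 2)
      (fun b _ => Finset.sum_nonneg fun a _ => by positivity) (Finset.mem_univ j))
    exact Finset.single_le_sum (f := fun a => ‖D.P w a j‖ ^ 2)
      (fun a _ => by positivity) (Finset.mem_univ i)
  nlinarith [norm_nonneg (D.P w i j)]

/-- The function `ξ ↦ f(ξ) χ_Δ(ξ) Π(ξ)`. -/
def channel (D : ModelData l d p r s) (f : HSpace l d p) (ξ : ℝ) :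
    EuclideanSpace ℂ (Fin r ⊕ Fin s) :=
  (Delta l d).indicator (fun ξ => rowMul (D.P ξ) (f ξ)) ξ

theorem integrable_channel_restrict (D : ModelData l d p r s) (f : HSpace l d p) :
    Integrable (fun ξ => rowMul (D.P ξ) (f ξ)) (muDelta l d) := by
  have hf : Integrable (fun ξ => f ξ) (muDelta l d) :=
    (Lp.memLp f).integrable (by norm_num)
  refine Integrable.mono'
    (hf.norm.const_mul (Fintype.card (Fin r ⊕ Fin s) * (Fintype.card (Fin p) * 1) : ℝ))
    (aestronglyMeasurable_rowMul D.measurable_P hf.aestronglyMeasurable) ?_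
  filter_upwards [ae_restrict_mem (measurableSet_Delta l d)] with w hw
  exact norm_rowMul_le _ _ (fun i j => D.norm_P_le hw i j) _

theorem integrable_channel (D : ModelData l d p r s) (f : HSpace l d p) :
    Integrable (D.channel f) :=
  (integrable_indicator_iff (measurableSet_Delta l d)).2 (D.integrable_channel_restrict f)

theorem channel_add (D : ModelData l d p r s) (f g : HSpace l d p) :
    D.channel (f + g) =ᵐ[volume] fun ξ => D.channel f ξ + D.channel g ξ := by
  have h : ∀ᵐ ξ ∂volume, ξ ∈ Delta l d → (f + g : HSpace l d p) ξ = f ξ + g ξ :=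
    (ae_restrict_iff' (measurableSet_Delta l d)).1 (Lp.coeFn_add f g)
  filter_upwards [h] with ξ hξ
  by_cases hm : ξ ∈ Delta l d
  · simp only [channel, Set.indicator_of_mem hm]
    rw [hξ hm]
    simp only [map_add]
  · simp [channel, hm]

theorem channel_smul (D : ModelData l d p r s) (c : ℂ) (f : HSpace l d p) :
    D.channel (c • f) =ᵐ[volume] fun ξ => c • D.channel f ξ := by
  have h : ∀ᵐ ξ ∂volume, ξ ∈ Delta l d → (c • f : HSpace l d p) ξ = c • f ξ :=
    (ae_restrict_iff' (measurableSet_Delta l d)).1 (Lp.coeFn_smul c f)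
  filter_upwards [h] with ξ hξ
  by_cases hm : ξ ∈ Delta l d
  · simp only [channel, Set.indicator_of_mem hm]
    rw [hξ hm]
    simp only [map_smul]
  · simp [channel, hm]

theorem exists_integral_norm_channel_le (D : ModelData l d p r s) :
    ∃ K : ℝ, 0 ≤ K ∧ ∀ f : HSpace l d p, ∫ ξ, ‖D.channel f ξ‖ ≤ K * ‖f‖ := by
  refine ⟨(Fintype.card (Fin r ⊕ Fin s) * (Fintype.card (Fin p) * 1) : ℝ) *
        (muDelta l d).real Set.univ ^ (2⁻¹ : ℝ), by positivity, fun f => ?_⟩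
  have hf : MemLp (fun ξ => f ξ) 1 (muDelta l d) :=
    (Lp.memLp f).mono_exponent (by norm_num)
  have h1 : ∫ ξ, ‖f ξ‖ ∂(muDelta l d) ≤ (muDelta l d).real Set.univ ^ (2⁻¹ : ℝ) * ‖f‖ := by
    have h2 := eLpNorm_le_eLpNorm_mul_rpow_measure_univ (p := 1) (q := 2) (μ := muDelta l d)
      (f := fun ξ => f ξ) (by norm_num) (Lp.aestronglyMeasurable f)
    have h3 := ENNReal.toReal_mono ?_ h2
    · rw [eLpNorm_one_eq_lintegral_enorm,
        ← integral_norm_eq_lintegral_enorm hf.aestronglyMeasurable, ENNReal.toReal_mul,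
        ← ENNReal.toReal_rpow] at h3
      rw [mul_comm, Lp.norm_def, measureReal_def]
      convert h3 using 3
      norm_num
    · refine ENNReal.mul_ne_top (Lp.memLp f).2.ne ?_
      exact ENNReal.rpow_ne_top_of_nonneg (by norm_num) (measure_ne_top _ _)
  have h4 : ∫ ξ, ‖D.channel f ξ‖ = ∫ ξ, ‖rowMul (D.P ξ) (f ξ)‖ ∂(muDelta l d) := by
    unfold muDelta
    rw [← integral_indicator (measurableSet_Delta l d)]
    simp only [channel, norm_indicator_eq_indicator_norm]
    rfl
  rw [h4, mul_assoc]
  refine le_trans (integral_mono_ae (D.integrable_channel_restrict f).norm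
    ((hf.integrable le_rfl).norm.const_mul
      (Fintype.card (Fin r ⊕ Fin s) * (Fintype.card (Fin p) * 1) : ℝ)) ?_) ?_
  · filter_upwards [ae_restrict_mem (measurableSet_Delta l d)] with w hw
    exact norm_rowMul_le _ _ (fun i j => D.norm_P_le hw i j) _
  · rw [integral_const_mul]
    gcongr

/-- `Φ f = ∫_Δ f(w) Π(w) dw`. -/
def Phi (D : ModelData l d p r s) : HSpace l d p →L[ℂ] EuclideanSpace ℂ (Fin r ⊕ Fin s) :=
  LinearMap.mkContinuousOfExistsBound
    { toFun := fun f => ∫ w, D.channel f w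
      map_add' := fun f g => by
        rw [integral_congr_ae (D.channel_add f g),
          integral_add (D.integrable_channel f) (D.integrable_channel g)]
      map_smul' := fun c f => by
        rw [integral_congr_ae (D.channel_smul c f), integral_smul, RingHom.id_apply] }
    (by
      obtain ⟨K, -, hK⟩ := D.exists_integral_norm_channel_le
      exact ⟨K, fun f => (norm_integral_le_integral_norm _).trans (hK f)⟩)

/-- The function `w ↦ (∫_{a(w)}^{b(w)} f(ξ) χ_Δ(ξ) Π(ξ) dξ) C Π*(w)`. -/
def volterraFun (D : ModelData l d p r s) (a b : ℝ → ℝ)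
    (C : Matrix (Fin r ⊕ Fin s) (Fin r ⊕ Fin s) ℂ) (f : HSpace l d p) (w : ℝ) :
    EuclideanSpace ℂ (Fin p) :=
  rowMul (C * (D.P w)ᴴ) (∫ ξ in (a w)..(b w), D.channel f ξ)

theorem exists_norm_CP_le (D : ModelData l d p r s)
    (C : Matrix (Fin r ⊕ Fin s) (Fin r ⊕ Fin s) ℂ) :
    ∃ K : ℝ, 0 ≤ K ∧ ∀ w ∈ Delta l d, ∀ i j, ‖(C * (D.P w)ᴴ) i j‖ ≤ K := by
  refine ⟨∑ i, ∑ k, ‖C i k‖, by positivity, fun w hw i j => ?_⟩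
  rw [Matrix.mul_apply]
  refine (norm_sum_le _ _).trans ?_
  refine le_trans (Finset.sum_le_sum (g := fun k => ‖C i k‖) fun k _ => ?_)
    (Finset.single_le_sum (f := fun i => ∑ k, ‖C i k‖) (fun i _ => by positivity)
      (Finset.mem_univ i))
  rw [norm_mul, Matrix.conjTranspose_apply, norm_star]
  exact mul_le_of_le_one_right (norm_nonneg _) (D.norm_P_le hw j k)

theorem aestronglyMeasurable_volterraFun (D : ModelData l d p r s) {a b : ℝ → ℝ}
    (ha : Continuous a) (hb : Continuous b)
    (C : Matrix (Fin r ⊕ Fin s) (Fin r ⊕ Fin s) ℂ) (f : HSpace l d p) :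
    AEStronglyMeasurable (D.volterraFun a b C f) (muDelta l d) := by
  refine aestronglyMeasurable_rowMul (fun i j => ?_) ?_
  · simp only [Matrix.mul_apply, Matrix.conjTranspose_apply]
    refine Finset.aemeasurable_fun_sum _ fun k _ => ?_
    exact aemeasurable_const.mul
      (Complex.continuous_conj.measurable.comp_aemeasurable (D.measurable_P j k))
  · have hi : ∀ x y, IntervalIntegrable (D.channel f) volume x y :=
      fun x y => (D.integrable_channel f).intervalIntegrable
    have hc := intervalIntegral.continuous_primitive hi 0
    have : (fun w => ∫ ξ in (a w)..(b w), D.channel f ξ) =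
        fun w => (∫ ξ in (0 : ℝ)..(b w), D.channel f ξ) - ∫ ξ in (0 : ℝ)..(a w), D.channel f ξ := by
      funext w
      rw [intervalIntegral.integral_interval_sub_left (hi _ _) (hi _ _)]
    rw [this]
    exact ((hc.comp hb).sub (hc.comp ha)).aestronglyMeasurable

theorem exists_norm_volterraFun_le (D : ModelData l d p r s) (a b : ℝ → ℝ)
    (C : Matrix (Fin r ⊕ Fin s) (Fin r ⊕ Fin s) ℂ) :
    ∃ K : ℝ, 0 ≤ K ∧ ∀ f : HSpace l d p, ∀ᵐ w ∂(muDelta l d),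
      ‖D.volterraFun a b C f w‖ ≤ K * ‖f‖ := by
  obtain ⟨K₁, h₁, hK₁⟩ := D.exists_integral_norm_channel_le
  obtain ⟨K₂, h₂, hK₂⟩ := D.exists_norm_CP_le C
  refine ⟨(Fintype.card (Fin p) * (Fintype.card (Fin r ⊕ Fin s) * K₂)) * K₁, by positivity,
    fun f => ?_⟩
  filter_upwards [ae_restrict_mem (measurableSet_Delta l d)] with w hw
  refine (norm_rowMul_le _ _ (fun i j => hK₂ w hw i j) _).trans ?_
  rw [mul_assoc _ K₁]
  gcongr
  refine (intervalIntegral.norm_integral_le_integral_norm_uIoc).trans ?_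
  refine le_trans ?_ (hK₁ f)
  exact setIntegral_le_integral (D.integrable_channel f).norm
    (Filter.Eventually.of_forall fun _ => norm_nonneg _)

theorem memLp_volterraFun (D : ModelData l d p r s) {a b : ℝ → ℝ}
    (ha : Continuous a) (hb : Continuous b)
    (C : Matrix (Fin r ⊕ Fin s) (Fin r ⊕ Fin s) ℂ) (f : HSpace l d p) :
    MemLp (D.volterraFun a b C f) 2 (muDelta l d) := by
  obtain ⟨K, -, hK⟩ := D.exists_norm_volterraFun_le a b C
  exact MemLp.of_bound (D.aestronglyMeasurable_volterraFun ha hb C f) _ (hK f)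

/-- The bounded operator `f ↦ (w ↦ (∫_{a(w)}^{b(w)} f(ξ) χ_Δ(ξ) Π(ξ) dξ) C Π*(w))`. -/
def volterra (D : ModelData l d p r s) (a b : ℝ → ℝ) (ha : Continuous a) (hb : Continuous b)
    (C : Matrix (Fin r ⊕ Fin s) (Fin r ⊕ Fin s) ℂ) : HSpace l d p →L[ℂ] HSpace l d p :=
  LinearMap.mkContinuousOfExistsBound
    { toFun := fun f => (D.memLp_volterraFun ha hb C f).toLp
      map_add' := fun f g => by
        rw [← MemLp.toLp_add]
        refine MemLp.toLp_congr _ _ (Filter.Eventually.of_forall fun w => ?_)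
        simp only [volterraFun, Pi.add_apply, ← map_add]
        rw [← intervalIntegral.integral_add (D.integrable_channel f).intervalIntegrable
          (D.integrable_channel g).intervalIntegrable]
        congr 1
        exact intervalIntegral.integral_congr_ae
          ((D.channel_add f g).mono fun ξ h _ => h)
      map_smul' := fun c f => by
        rw [RingHom.id_apply, ← MemLp.toLp_const_smul]
        refine MemLp.toLp_congr _ _ (Filter.Eventually.of_forall fun w => ?_)
        simp only [volterraFun, Pi.smul_apply, ← map_smul]
        rw [← intervalIntegral.integral_smul]
        congr 1
        exact intervalIntegral.integral_congr_ae
          ((D.channel_smul c f).mono fun ξ h _ => h) }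
    (by
      obtain ⟨K, hK0, hK⟩ := D.exists_norm_volterraFun_le a b C
      refine ⟨(muDelta l d).real Set.univ ^ (2 : ENNReal).toReal⁻¹ * K, fun f => ?_⟩
      rw [mul_assoc]
      refine Lp.norm_le_of_ae_bound (by positivity) ?_
      filter_upwards [(D.memLp_volterraFun ha hb C f).coeFn_toLp, hK f] with w h1 h2
      simpa only [LinearMap.coe_mk, AddHom.coe_mk, h1] using h2)

end ModelData

theorem abs_le_of_mem_Delta {l d w : ℝ} (hw : w ∈ Delta l d) : |w| ≤ |l| + |d| := by
  rw [Delta, Set.mem_union, Set.mem_Icc, Set.mem_Icc] at hw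
  have h1 := le_abs_self l
  have h2 := neg_abs_le l
  have h3 := le_abs_self d
  have h4 := neg_abs_le d
  rw [abs_le]
  rcases hw with hw | hw <;> constructor <;> linarith [hw.1, hw.2, abs_nonneg l, abs_nonneg d]

theorem memLp_mulFun (f : HSpace l d p) :
    MemLp (fun w : ℝ => (w : ℂ) • f w) 2 (muDelta l d) := by
  refine MemLp.of_le_mul (c := |l| + |d|) (Lp.memLp f) ?_ ?_
  · exact (Complex.continuous_ofReal.aestronglyMeasurable).smul (Lp.aestronglyMeasurable f)
  · filter_upwards [ae_restrict_mem (measurableSet_Delta l d)] with w hw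
    rw [norm_smul, Complex.norm_real, Real.norm_eq_abs]
    gcongr
    exact abs_le_of_mem_Delta hw

/-- Multiplication by the independent variable, `f(w) ↦ w f(w)`. -/
def mulVar (l d : ℝ) (p : ℕ) : HSpace l d p →L[ℂ] HSpace l d p :=
  LinearMap.mkContinuousOfExistsBound
    { toFun := fun f => (memLp_mulFun f).toLp
      map_add' := fun f g => by
        rw [← MemLp.toLp_add]
        refine MemLp.toLp_congr _ _ ?_
        filter_upwards [Lp.coeFn_add f g] with w hw
        rw [hw, Pi.add_apply, Pi.add_apply, smul_add]
      map_smul' := fun c f => by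
        rw [RingHom.id_apply, ← MemLp.toLp_const_smul]
        refine MemLp.toLp_congr _ _ ?_
        filter_upwards [Lp.coeFn_smul c f] with w hw
        rw [hw, Pi.smul_apply, Pi.smul_apply, smul_comm] }
    (by
      refine ⟨|l| + |d|, fun f => ?_⟩
      refine Lp.norm_le_mul_norm_of_ae_le_mul ?_
      filter_upwards [(memLp_mulFun f).coeFn_toLp,
        ae_restrict_mem (measurableSet_Delta l d)] with w h1 hw
      simp only [LinearMap.coe_mk, AddHom.coe_mk, h1]
      rw [norm_smul, Complex.norm_real, Real.norm_eq_abs]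
      gcongr
      exact abs_le_of_mem_Delta hw)

namespace ModelData

/-- The triangular model (coupling)
`Bf(w) = w f(w) - i ∫_{-l}^w f Π S* Π*(w) dξ + i ∫_w^l f Π S Π*(w) dξ + i ∫_{-l}^w f Π L Π*(w) dξ`
on `L²(Δ; ℂ^p)`. -/
def B (D : ModelData l d p r s) : HSpace l d p →L[ℂ] HSpace l d p :=
  mulVar l d p
    - Complex.I • D.volterra (fun _ => -l) (fun w => w) continuous_const continuous_id' D.Sᴴ
    + Complex.I • D.volterra (fun w => w) (fun _ => l) continuous_id' continuous_const D.S
    + Complex.I • D.volterra (fun _ => -l) (fun w => w) continuous_const continuous_id' D.L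

/-- `A = B⁻¹` (used only for invertible `B`). -/
def A (D : ModelData l d p r s) : HSpace l d p →L[ℂ] HSpace l d p := Ring.inverse D.B

/-- The external space `E = ℂ^{2m}`. -/
abbrev E (r s : ℕ) : Type := EuclideanSpace ℂ ((Fin r ⊕ Fin s) ⊕ (Fin r ⊕ Fin s))

/-- `Φ̃ f = (Φ f, Φ (B⁻¹)* f)`. -/
def PhiT (D : ModelData l d p r s) : HSpace l d p →L[ℂ] E r s :=
  (PiLp.continuousLinearEquiv 2 ℂ fun _ : (Fin r ⊕ Fin s) ⊕ (Fin r ⊕ Fin s) => ℂ).symm.toContinuousLinearMap ∘L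
    ContinuousLinearMap.pi (Sum.elim
      (fun k => EuclideanSpace.proj k ∘L D.Phi)
      (fun k => EuclideanSpace.proj k ∘L D.Phi ∘L adjoint D.A))

/-- `σ_A = [[0, 0], [0, -L]]`. -/
def sigmaA (D : ModelData l d p r s) : E r s →L[ℂ] E r s :=
  rowMul (Matrix.fromBlocks 0 0 0 (-D.L))

/-- `σ_B = [[L, 0], [0, 0]]`. -/
def sigmaB (D : ModelData l d p r s) : E r s →L[ℂ] E r s :=
  rowMul (Matrix.fromBlocks D.L 0 0 0)

/-- `γ = [[0, -L], [-L, 0]]`. -/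
def gamma (D : ModelData l d p r s) : E r s →L[ℂ] E r s :=
  rowMul (Matrix.fromBlocks 0 (-D.L) (-D.L) 0)

/-- `γ̃ = γ + i (σ_A Φ̃ Φ̃* σ_B - σ_B Φ̃ Φ̃* σ_A)`. -/
def gammaT (D : ModelData l d p r s) : E r s →L[ℂ] E r s :=
  D.gamma + Complex.I • (D.sigmaA ∘L D.PhiT ∘L adjoint D.PhiT ∘L D.sigmaB
    - D.sigmaB ∘L D.PhiT ∘L adjoint D.PhiT ∘L D.sigmaA)

end ModelData

/-! ### Colligations, collective motions and solitonic combinations -/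

section Abstract

variable {H : Type*} [NormedAddCommGroup H] [InnerProductSpace ℂ H] [CompleteSpace H]
variable {E : Type*} [NormedAddCommGroup E] [InnerProductSpace ℂ E] [CompleteSpace E]

/-- `X = (A, B; H, Φ, E; σ_A, σ_B, γ, γ̃)` is a commutative regular colligation. -/
structure IsRegularColligation (A B : H →L[ℂ] H) (Φ : H →L[ℂ] E)
    (σA σB γ γt : E →L[ℂ] E) : Prop where
  comm : A ∘L B = B ∘L A
  selfAdjoint_σA : IsSelfAdjoint σA
  selfAdjoint_σB : IsSelfAdjoint σB
  selfAdjoint_γ : IsSelfAdjoint γ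
  selfAdjoint_γt : IsSelfAdjoint γt
  im_A : Complex.I⁻¹ • (A - adjoint A) = adjoint Φ ∘L σA ∘L Φ
  im_B : Complex.I⁻¹ • (B - adjoint B) = adjoint Φ ∘L σB ∘L Φ
  input : σA ∘L Φ ∘L adjoint B - σB ∘L Φ ∘L adjoint A = γ ∘L Φ
  output : σA ∘L Φ ∘L B - σB ∘L Φ ∘L A = γt ∘L Φ
  link : γt - γ = Complex.I • (σA ∘L Φ ∘L adjoint Φ ∘L σB - σB ∘L Φ ∘L adjoint Φ ∘L σA)

/-- The collective motion `T(x,t) = exp(i(ε t A + δ x B))` with `ε = -1`, `δ = 1`. -/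
def motion (A B : H →L[ℂ] H) (x t : ℝ) : H →L[ℂ] H :=
  NormedSpace.exp (Complex.I • (-(t : ℂ) • A + (x : ℂ) • B))

/-- The collective motion `T*⁻¹(x,t) = exp(i(ε̄ t A* + δ̄ x B*))` with `ε = -1`, `δ = 1`. -/
def adjMotion (A B : H →L[ℂ] H) (x t : ℝ) : H →L[ℂ] H :=
  NormedSpace.exp (Complex.I • (-(t : ℂ) • adjoint A + (x : ℂ) • adjoint B))

/-- `Γ(x,t) = T(x,t) N + M₁ T*⁻¹(x,t) M`. -/
def Gam (A B N M₁ M : H →L[ℂ] H) (x t : ℝ) : H →L[ℂ] H :=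
  motion A B x t ∘L N + M₁ ∘L adjMotion A B x t ∘L M

/-- The solitonic combination `S(x,t) = Γ⁻¹(x,t) Γ_x(x,t)` (meant where `Γ(x,t)` is
invertible). -/
def soliton (A B N M₁ M : H →L[ℂ] H) (x t : ℝ) : H →L[ℂ] H :=
  Ring.inverse (Gam A B N M₁ M x t) ∘L deriv (fun y : ℝ => Gam A B N M₁ M y t) x

/-- At the point `(x,t)` the operator function `S` has an invertible value, is differentiable in
`x` (also for all nearby values of the time), and satisfies the Sine-Gordon equation
`∂_t (S⁻¹ ∂_x S) = B̃ S⁻¹ B̃ S - S⁻¹ B̃ S B̃`. -/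
def SineGordonAt (Bt : H →L[ℂ] H) (S : ℝ → ℝ → H →L[ℂ] H) (x t : ℝ) : Prop :=
  IsUnit (S x t) ∧
  (∀ᶠ τ in 𝓝 t, DifferentiableAt ℝ (fun y : ℝ => S y τ) x) ∧
  HasDerivAt (fun τ : ℝ => Ring.inverse (S x τ) ∘L deriv (fun y : ℝ => S y τ) x)
    (Bt ∘L Ring.inverse (S x t) ∘L Bt ∘L S x t
      - Ring.inverse (S x t) ∘L Bt ∘L S x t ∘L Bt) t

/-- `M = ∫_0^∞ exp(-ixB*) ρ ((B - B*)/i) exp(ixB) dx`, as a strong limit of `∫_0^R`. -/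
def IsStrongIntegral (B ρ M : H →L[ℂ] H) : Prop :=
  ∀ f : H, Tendsto
    (fun R : ℝ => ∫ x in (0 : ℝ)..R,
      NormedSpace.exp (-(Complex.I * (x : ℂ)) • adjoint B)
        (ρ ((Complex.I⁻¹ • (B - adjoint B)) (NormedSpace.exp ((Complex.I * (x : ℂ)) • B) f))))
    atTop (𝓝 (M f))

/-- The mode `v_h(ξ) = Φ exp(iξB) h` of the element `h`. -/
def mode (B : H →L[ℂ] H) (Φ : H →L[ℂ] E) (h : H) (ξ : ℝ) : E :=
  Φ (NormedSpace.exp ((Complex.I * (ξ : ℂ)) • B) h)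

/-- `Ψ(x,t) = Φ T(x,t) ρ̃ Φ* σ_B = Φ exp(i(-tA + xB)) ρ̃ Φ* σ_B`. -/
def Psi (A B : H →L[ℂ] H) (Φ : H →L[ℂ] E) (σB : E →L[ℂ] E) (ρt : H →L[ℂ] H) (x t : ℝ) :
    E →L[ℂ] E :=
  Φ ∘L motion A B x t ∘L ρt ∘L adjoint Φ ∘L σB

/-- `P₁ = (I + B̃)/2`. -/
def P₁ (Bt : H →L[ℂ] H) : H →L[ℂ] H := (2⁻¹ : ℂ) • (1 + Bt)

/-- The generalized Gelfand-Levitan-Marchenko equation at the point `(x,t)`, for all `ξ`: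
the improper integral `∫_0^∞ Ψ(-2x+ξ+η,-2t) v_h(η) dη` converges and
`v_k(ξ) = -∫_0^∞ Ψ(-2x+ξ+η,-2t) v_h(η) dη + Ψ(-2x+ξ,-2t) v_g(0)`. -/
def GLMEquation (A B : H →L[ℂ] H) (Φ : H →L[ℂ] E) (σB : E →L[ℂ] E) (ρt : H →L[ℂ] H)
    (x t : ℝ) (k h g : H) : Prop :=
  ∀ ξ : ℝ, ∃ J : E,
    Tendsto (fun R : ℝ => ∫ η in (0 : ℝ)..R,
      Psi A B Φ σB ρt (-2 * x + ξ + η) (-2 * t) (mode B Φ h η)) atTop (𝓝 J) ∧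
    mode B Φ k ξ = -J + Psi A B Φ σB ρt (-2 * x + ξ) (-2 * t) (mode B Φ g 0)

end Abstract

end SolitonGLM

end

/-!
Since `U*` intertwines `B*` with `-B`, and hence `A*` with `-A`, the operator
`Γ(x,t) = T(x,t) N + T(-x,-t) U* M` solves the linear system `Γ_x = iB Γ B̃`, `Γ_t = -iA Γ B̃`.
The two coefficients are mutually inverse, so `S = Γ⁻¹Γ_x` and `W = Γ⁻¹Γ_t` satisfy
`S B̃ W = W B̃ S = B̃`; together with `S⁻¹S_x = B̃SB̃ - S` and `S_t = 1 - WS` this is the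
Sine-Gordon equation.

Strong convergence of the integral defining `M` yields the Lyapunov equation
`i (B*M - MB) = ρ (B - B*)/i`, so that `Γ (Sg - iBg) = T(-x,-t) U* ρ ((B - B*)/i) g`.
Multiplying by `T(-x,-t)` gives `N h = T(-2x,-2t) U* (ρ ((B - B*)/i) g - M h)`, and applying
`Φ̃ e^{iξB}` turns this into the Gelfand-Levitan-Marchenko equation because
`(B - B*)/i = Φ̃* σ_B Φ̃`. For the triangular model this factorization amounts to
`B - B* = i Φ* L Φ`: by Fubini the adjoint of `f ↦ ∫_w^l f Π C Π*(w)` is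
`f ↦ ∫_{-l}^w f Π C* Π*(w)`, and `∫_{-l}^w + ∫_w^l = Φ`.
-/

noncomputable section

namespace SolitonGLM

open scoped Ring

/-- The left logarithmic derivative `G⁻¹G'` of a function with values in a ring; where `G x` is
not a unit it takes the junk value `0`. -/
def leftLogDeriv {𝕜 R : Type*} [NontriviallyNormedField 𝕜] [NormedRing R] [NormedAlgebra 𝕜 R]
    (G : 𝕜 → R) (x : 𝕜) : R :=
  (G x)⁻¹ʳ * deriv G x

/-- The linear system `∂ₓG = b G C`, `∂ₜG = a G C` with constant coefficients, whose logarithmic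
derivatives in `x` are the Sine-Gordon solutions. For the combination `Γ` of collective motions
the coefficients are `a = -iA`, `b = iB`, `C = B̃`. -/
structure SolvesLinearSystem {𝕜 R : Type*} [NontriviallyNormedField 𝕜] [NormedRing R]
    [NormedAlgebra 𝕜 R] (a b C : R) (G : 𝕜 → 𝕜 → R) : Prop where
  space : ∀ x t, HasDerivAt (fun y => G y t) (b * G x t * C) x
  time : ∀ x t, HasDerivAt (fun τ => G x τ) (a * G x t * C) t

section LogDeriv

variable {𝕜 R : Type*} [NontriviallyNormedField 𝕜] [NormedRing R] [NormedAlgebra 𝕜 R]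

theorem hasDerivAt_ringInverse_mul [HasSummableGeomSeries R] {G F : 𝕜 → R} {G' F' : R} {x : 𝕜}
    (hG : HasDerivAt G G' x) (hF : HasDerivAt F F' x) (hx : IsUnit (G x)) :
    HasDerivAt (fun y => (G y)⁻¹ʳ * F y)
      ((G x)⁻¹ʳ * F' - (G x)⁻¹ʳ * G' * ((G x)⁻¹ʳ * F x)) x := by
  obtain ⟨u, hu⟩ := hx
  have hinv : HasDerivAt (fun y => (G y)⁻¹ʳ) (-((G x)⁻¹ʳ * G' * (G x)⁻¹ʳ)) x := by
    have h := hasFDerivAt_ringInverse (𝕜 := 𝕜) u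
    rw [hu] at h
    refine (h.comp_hasDerivAt x hG).congr_deriv ?_
    rw [← hu, Ring.inverse_unit]
    rfl
  refine (hinv.mul hF).congr_deriv ?_
  noncomm_ring

namespace SolvesLinearSystem

variable {a b C : R} {G : 𝕜 → 𝕜 → R} {x t : 𝕜}

theorem swap (h : SolvesLinearSystem a b C G) : SolvesLinearSystem b a C fun t x => G x t :=
  ⟨fun t x => h.time x t, fun t x => h.space x t⟩

theorem leftLogDeriv_space (h : SolvesLinearSystem a b C G) (x t : 𝕜) :
    leftLogDeriv (fun y => G y t) x = (G x t)⁻¹ʳ * (b * G x t * C) := by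
  rw [leftLogDeriv, (h.space x t).deriv]

theorem leftLogDeriv_time (h : SolvesLinearSystem a b C G) (x t : 𝕜) :
    leftLogDeriv (fun τ => G x τ) t = (G x t)⁻¹ʳ * (a * G x t * C) :=
  h.swap.leftLogDeriv_space t x

theorem leftLogDeriv_space_mul_leftLogDeriv_time (h : SolvesLinearSystem a b C G)
    (hba : b * a = 1) (hC : C * C = 1) (hG : IsUnit (G x t)) :
    leftLogDeriv (fun y => G y t) x * C * leftLogDeriv (fun τ => G x τ) t = C := by
  rw [h.leftLogDeriv_space, h.leftLogDeriv_time]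
  calc (G x t)⁻¹ʳ * (b * G x t * C) * C * ((G x t)⁻¹ʳ * (a * G x t * C))
      = (G x t)⁻¹ʳ * b * G x t * (C * C) * (G x t)⁻¹ʳ * a * G x t * C := by noncomm_ring
    _ = (G x t)⁻¹ʳ * (b * (G x t * (G x t)⁻¹ʳ) * a) * G x t * C := by rw [hC]; noncomm_ring
    _ = C := by
      rw [Ring.mul_inverse_cancel _ hG, mul_one, hba, mul_one, Ring.inverse_mul_cancel _ hG,
        one_mul]

theorem leftLogDeriv_time_mul_leftLogDeriv_space (h : SolvesLinearSystem a b C G)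
    (hab : a * b = 1) (hC : C * C = 1) (hG : IsUnit (G x t)) :
    leftLogDeriv (fun τ => G x τ) t * C * leftLogDeriv (fun y => G y t) x = C :=
  h.swap.leftLogDeriv_space_mul_leftLogDeriv_time hab hC hG

theorem isUnit_leftLogDeriv_space (h : SolvesLinearSystem a b C G) (hab : a * b = 1)
    (hba : b * a = 1) (hC : C * C = 1) (hG : IsUnit (G x t)) :
    IsUnit (leftLogDeriv (fun y => G y t) x) := by
  refine isUnit_iff_exists.2 ⟨C * leftLogDeriv (fun τ => G x τ) t * C, ?_, ?_⟩
  · rw [← mul_assoc, ← mul_assoc, h.leftLogDeriv_space_mul_leftLogDeriv_time hba hC hG, hC]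
  · rw [mul_assoc, mul_assoc, ← mul_assoc _ C, h.leftLogDeriv_time_mul_leftLogDeriv_space hab hC hG,
      hC]

theorem leftLogDeriv_time_eq (h : SolvesLinearSystem a b C G) (hab : a * b = 1)
    (hba : b * a = 1) (hC : C * C = 1) (hG : IsUnit (G x t)) :
    leftLogDeriv (fun τ => G x τ) t = C * (leftLogDeriv (fun y => G y t) x)⁻¹ʳ * C := by
  have hS := h.isUnit_leftLogDeriv_space hab hba hC hG
  calc leftLogDeriv (fun τ => G x τ) t
      = leftLogDeriv (fun τ => G x τ) t * C * leftLogDeriv (fun y => G y t) x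
          * (leftLogDeriv (fun y => G y t) x)⁻¹ʳ * C := by
        rw [Ring.mul_inverse_cancel_right _ _ hS, mul_assoc, hC, mul_one]
    _ = C * (leftLogDeriv (fun y => G y t) x)⁻¹ʳ * C := by
        rw [h.leftLogDeriv_time_mul_leftLogDeriv_space hab hC hG]

variable [HasSummableGeomSeries R]

theorem hasDerivAt_leftLogDeriv_space (h : SolvesLinearSystem a b C G) (hC : C * C = 1)
    (hG : IsUnit (G x t)) :
    HasDerivAt (fun y => leftLogDeriv (fun z => G z t) y)
      (leftLogDeriv (fun y => G y t) x *
        (C * leftLogDeriv (fun y => G y t) x * C - leftLogDeriv (fun y => G y t) x)) x := by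
  simp only [h.leftLogDeriv_space]
  refine (hasDerivAt_ringInverse_mul (h.space x t) (((h.space x t).const_mul b).mul_const C)
    hG).congr_deriv ?_
  rw [mul_sub]
  congr 1
  calc (G x t)⁻¹ʳ * (b * (b * G x t * C) * C)
      = (G x t)⁻¹ʳ * b * (G x t * (C * C) * (G x t)⁻¹ʳ) * b * G x t * C * C := by
        rw [hC, mul_one, Ring.mul_inverse_cancel _ hG]; noncomm_ring
    _ = (G x t)⁻¹ʳ * (b * G x t * C) * (C * ((G x t)⁻¹ʳ * (b * G x t * C)) * C) := by
        noncomm_ring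

theorem hasDerivAt_leftLogDeriv_space_time (h : SolvesLinearSystem a b C G) (hba : b * a = 1)
    (hC : C * C = 1) (hG : IsUnit (G x t)) :
    HasDerivAt (fun τ => leftLogDeriv (fun y => G y τ) x)
      (1 - leftLogDeriv (fun τ => G x τ) t * leftLogDeriv (fun y => G y t) x) t := by
  simp only [h.leftLogDeriv_space, h.leftLogDeriv_time]
  refine (hasDerivAt_ringInverse_mul (h.time x t) (((h.time x t).const_mul b).mul_const C)
    hG).congr_deriv ?_
  congr 1
  calc (G x t)⁻¹ʳ * (b * (a * G x t * C) * C)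
      = (G x t)⁻¹ʳ * (b * a) * G x t * (C * C) := by noncomm_ring
    _ = 1 := by rw [hba, hC, mul_one, mul_one, Ring.inverse_mul_cancel _ hG]

theorem eventually_isUnit (h : SolvesLinearSystem a b C G) (hG : IsUnit (G x t)) :
    ∀ᶠ τ in 𝓝 t, IsUnit (G x τ) :=
  (h.time x t).continuousAt.eventually (Units.isOpen.mem_nhds hG)

/-- Since `S⁻¹Sₓ = CSC - S` and `Sₜ = 1 - WS` with `W = G⁻¹Gₜ = C S⁻¹ C`, the `t`-derivative of
`S⁻¹Sₓ` is `WS - C W S C`. -/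
theorem hasDerivAt_leftLogDeriv_leftLogDeriv (h : SolvesLinearSystem a b C G) (hab : a * b = 1)
    (hba : b * a = 1) (hC : C * C = 1) (hG : IsUnit (G x t)) :
    HasDerivAt (fun τ => leftLogDeriv (fun y => leftLogDeriv (fun z => G z τ) y) x)
      (C * (leftLogDeriv (fun y => G y t) x)⁻¹ʳ * C * leftLogDeriv (fun y => G y t) x
        - (leftLogDeriv (fun y => G y t) x)⁻¹ʳ * C * leftLogDeriv (fun y => G y t) x * C) t := by
  have hS := h.hasDerivAt_leftLogDeriv_space_time hba hC hG
  have hderiv := ((hS.const_mul C).mul_const C).sub hS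
  refine (hderiv.congr_of_eventuallyEq ?_).congr_deriv ?_
  · filter_upwards [h.eventually_isUnit hG] with τ hτ
    rw [leftLogDeriv, (h.hasDerivAt_leftLogDeriv_space hC hτ).deriv,
      Ring.inverse_mul_cancel_left _ _ (h.isUnit_leftLogDeriv_space hab hba hC hτ)]
    rfl
  · rw [h.leftLogDeriv_time_eq hab hba hC hG]
    set S := leftLogDeriv (fun y => G y t) x
    calc C * (1 - C * S⁻¹ʳ * C * S) * C - (1 - C * S⁻¹ʳ * C * S)
        = C * C - C * C * S⁻¹ʳ * C * S * C - 1 + C * S⁻¹ʳ * C * S := by noncomm_ring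
      _ = C * S⁻¹ʳ * C * S - S⁻¹ʳ * C * S * C := by rw [hC]; noncomm_ring

end SolvesLinearSystem

end LogDeriv

section SineGordon

variable {H : Type*} [NormedAddCommGroup H] [InnerProductSpace ℂ H] [CompleteSpace H]

theorem SolvesLinearSystem.sineGordonAt {a b C : H →L[ℂ] H} {G : ℝ → ℝ → H →L[ℂ] H}
    (h : SolvesLinearSystem a b C G) (hab : a * b = 1) (hba : b * a = 1) (hC : C * C = 1)
    {x t : ℝ} (hG : IsUnit (G x t)) :
    SineGordonAt C (fun x t => leftLogDeriv (fun y => G y t) x) x t :=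
  ⟨h.isUnit_leftLogDeriv_space hab hba hC hG,
    (h.eventually_isUnit hG).mono fun _ hτ =>
      (h.hasDerivAt_leftLogDeriv_space hC hτ).differentiableAt,
    h.hasDerivAt_leftLogDeriv_leftLogDeriv hab hba hC hG⟩

end SineGordon

section Motion

variable {H : Type*} [NormedAddCommGroup H] [InnerProductSpace ℂ H] [CompleteSpace H]
variable {A B A' B' : H →L[ℂ] H}

theorem semiconjBy_of_mul_eq_one {R : Type*} [Monoid R] {z x y x' y' : R} (h : SemiconjBy z x y)
    (hx : x * x' = 1) (hy : y' * y = 1) : SemiconjBy z x' y' :=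
  calc z * x' = y' * y * z * x' := by rw [hy, one_mul]
    _ = y' * (z * x) * x' := by rw [h.eq, mul_assoc y' y z]
    _ = y' * z := by rw [mul_assoc, mul_assoc, hx, mul_one]

theorem motion_zero (A B : H →L[ℂ] H) : motion A B 0 0 = 1 := by
  simp [motion, NormedSpace.exp_zero]

theorem motion_time_zero (A B : H →L[ℂ] H) (x : ℝ) :
    motion A B x 0 = NormedSpace.exp ((Complex.I * (x : ℂ)) • B) := by
  simp only [motion, Complex.ofReal_zero, neg_zero, zero_smul, zero_add, smul_smul]

theorem motion_neg (A B : H →L[ℂ] H) (x t : ℝ) :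
    motion (-A) (-B) x t = motion A B (-x) (-t) := by
  simp [motion]

theorem motion_swap (A B : H →L[ℂ] H) (x t : ℝ) : motion A B x t = motion (-B) (-A) t x := by
  simp [motion, add_comm]

theorem motion_add (hAB : Commute A B) (x t x' t' : ℝ) :
    motion A B (x + x') (t + t') = motion A B x t * motion A B x' t' := by
  let +nondep : NormedAlgebra ℚ (H →L[ℂ] H) := .restrictScalars ℚ ℂ (H →L[ℂ] H)
  rw [motion, motion, motion, ← NormedSpace.exp_add_of_commute]
  · congr 1
    push_cast
    module
  · have hA : Commute A (-(t' : ℂ) • A + (x' : ℂ) • B) :=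
      ((Commute.refl A).smul_right _).add_right (hAB.smul_right _)
    have hB : Commute B (-(t' : ℂ) • A + (x' : ℂ) • B) :=
      (hAB.symm.smul_right _).add_right ((Commute.refl B).smul_right _)
    exact (((hA.smul_left _).add_left (hB.smul_left _)).smul_left _).smul_right _

theorem semiconjBy_motion {Z : H →L[ℂ] H} (hA : SemiconjBy Z A A') (hB : SemiconjBy Z B B')
    (x t : ℝ) : SemiconjBy Z (motion A B x t) (motion A' B' x t) := by
  let +nondep : NormedAlgebra ℚ (H →L[ℂ] H) := .restrictScalars ℚ ℂ (H →L[ℂ] H)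
  exact (((hA.smul_right _).add_right (hB.smul_right _)).smul_right _).exp_right

theorem hasDerivAt_motion_space (hAB : Commute A B) (x t : ℝ) :
    HasDerivAt (fun y : ℝ => motion A B y t) ((Complex.I • B) * motion A B x t) x := by
  have hfactor (y : ℝ) :
      motion A B y t = NormedSpace.exp (y • (Complex.I • B)) * motion A B 0 t := by
    have h := motion_add hAB y 0 0 t
    rwa [add_zero, zero_add, motion_time_zero, mul_comm, ← smul_smul, Complex.coe_smul] at h
  have hexp := hasDerivAt_exp_smul_const' (𝕂 := ℝ) (Complex.I • B) x
  rw [hfactor x, ← mul_assoc, funext hfactor]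
  exact hexp.mul_const _

theorem hasDerivAt_motion_time (hAB : Commute A B) (x t : ℝ) :
    HasDerivAt (fun τ : ℝ => motion A B x τ) (-(Complex.I • A) * motion A B x t) t := by
  simp only [motion_swap A B, ← smul_neg]
  exact hasDerivAt_motion_space (hAB.symm.neg_left.neg_right) t x

theorem semiconjBy_adjoint_neg {Z : H →L[ℂ] H} (hAB : A * B = 1)
    (hB : SemiconjBy Z (adjoint B) (-B)) : SemiconjBy Z (adjoint A) (-A) := by
  refine semiconjBy_of_mul_eq_one hB ?_ (by rw [neg_mul_neg, hAB])
  rw [← star_eq_adjoint, ← star_eq_adjoint, ← star_mul, hAB, star_one]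

theorem Gam_eq {N M₁ M : H →L[ℂ] H} (hA : SemiconjBy M₁ (adjoint A) (-A))
    (hB : SemiconjBy M₁ (adjoint B) (-B)) (x t : ℝ) :
    Gam A B N M₁ M x t = motion A B x t * N + motion A B (-x) (-t) * (M₁ * M) := by
  rw [← motion_neg, ← mul_assoc, ← (semiconjBy_motion hA hB x t).eq, mul_assoc]
  rfl

theorem solvesLinearSystem_Gam {N M₁ M C : H →L[ℂ] H} (hAB : Commute A B)
    (hA : SemiconjBy M₁ (adjoint A) (-A)) (hB : SemiconjBy M₁ (adjoint B) (-B))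
    (hN : N * C = N) (hM : M * C = -M) :
    SolvesLinearSystem (-(Complex.I • A)) (Complex.I • B) C (Gam A B N M₁ M) := by
  have hAB' : Commute (-A) (-B) := hAB.neg_left.neg_right
  simp only [funext₂ (Gam_eq hA hB), ← motion_neg]
  constructor <;> intro x t
  · refine (((hasDerivAt_motion_space hAB x t).mul_const N).add
      ((hasDerivAt_motion_space hAB' x t).mul_const (M₁ * M))).congr_deriv ?_
    simp only [mul_assoc, mul_add, add_mul, hN, hM, smul_neg, neg_mul, mul_neg]
  · refine (((hasDerivAt_motion_time hAB x t).mul_const N).add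
      ((hasDerivAt_motion_time hAB' x t).mul_const (M₁ * M))).congr_deriv ?_
    simp only [mul_assoc, mul_add, add_mul, hN, hM, smul_neg, neg_mul, mul_neg]

end Motion

section SineGordonSoliton

variable {H : Type*} [NormedAddCommGroup H] [InnerProductSpace ℂ H] [CompleteSpace H]

theorem sineGordonAt_soliton {A B N M₁ M C : H →L[ℂ] H} (hAB : A * B = 1) (hBA : B * A = 1)
    (hB : SemiconjBy M₁ (adjoint B) (-B)) (hN : N * C = N) (hM : M * C = -M) (hC : C * C = 1)
    {x t : ℝ} (hG : IsUnit (Gam A B N M₁ M x t)) :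
    SineGordonAt C (soliton A B N M₁ M) x t :=
  (solvesLinearSystem_Gam (hAB.trans hBA.symm) (semiconjBy_adjoint_neg hAB hB) hB hN
    hM).sineGordonAt (by simp [smul_smul, hAB]) (by simp [smul_smul, hBA]) hC hG

end SineGordonSoliton

section Sylvester

theorem eq_zero_of_tendsto_of_tendsto_intervalIntegral {V : Type*} [NormedAddCommGroup V]
    [NormedSpace ℝ V] [CompleteSpace V] {F : ℝ → V} {v w : V} (hF : Continuous F)
    (hv : Tendsto F atTop (𝓝 v))
    (hw : Tendsto (fun R : ℝ => ∫ x in (0 : ℝ)..R, F x) atTop (𝓝 w)) : v = 0 := by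
  have hshift : Tendsto (fun R : ℝ => ∫ x in R..(R + 1), F x) atTop (𝓝 0) := by
    have h := (hw.comp (tendsto_atTop_add_const_right _ 1 tendsto_id)).sub hw
    rw [sub_self] at h
    refine h.congr fun R => ?_
    exact intervalIntegral.integral_interval_sub_left (hF.intervalIntegrable _ _)
      (hF.intervalIntegrable _ _)
  have hmean : Tendsto (fun R : ℝ => ∫ x in (0 : ℝ)..1, F (R + x)) atTop (𝓝 v) := by
    have hbound : ∀ᶠ R in atTop, ∀ y ≥ R, ‖F y‖ ≤ ‖v‖ + 1 := by
      exact eventually_forall_ge_atTop.2 (hv.norm.eventually (ge_mem_nhds (lt_add_one ‖v‖)))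
    have h := intervalIntegral.tendsto_integral_filter_of_dominated_convergence
      (μ := volume) (a := (0 : ℝ)) (b := 1) (l := atTop) (F := fun R x : ℝ => F (R + x))
      (f := fun _ => v) (fun _ => ‖v‖ + 1)
      (.of_forall fun R => (hF.comp (continuous_const_add R)).aestronglyMeasurable) ?_
      intervalIntegrable_const
      (.of_forall fun x _ => hv.comp (tendsto_atTop_add_const_right _ x tendsto_id))
    · simpa using h
    · filter_upwards [hbound] with R hR
      refine .of_forall fun x hx => hR _ ?_
      rw [Set.uIoc_of_le zero_le_one] at hx
      exact le_add_of_nonneg_right hx.1.le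
  refine tendsto_nhds_unique hmean (hshift.congr fun R => ?_)
  simp [intervalIntegral.integral_comp_add_left]

variable {V : Type*} [NormedAddCommGroup V] [NormedSpace ℂ V] [CompleteSpace V]

/-- The operator function `exp(xX) Z exp(xY)`, whose integral over `[0, ∞)` solves the Sylvester
equation `XM + MY = -Z`. -/
def expSandwich (X Y Z : V →L[ℂ] V) (x : ℝ) : V →L[ℂ] V :=
  NormedSpace.exp (x • X) * Z * NormedSpace.exp (x • Y)

theorem hasDerivAt_expSandwich (X Y Z : V →L[ℂ] V) (x : ℝ) :
    HasDerivAt (expSandwich X Y Z) (X * expSandwich X Y Z x + expSandwich X Y Z x * Y) x := by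
  refine (((hasDerivAt_exp_smul_const' (𝕂 := ℝ) X x).mul_const Z).mul
    (hasDerivAt_exp_smul_const (𝕂 := ℝ) Y x)).congr_deriv ?_
  simp only [expSandwich, mul_assoc]

theorem continuous_expSandwich_apply (X Y Z : V →L[ℂ] V) (v : V) :
    Continuous fun x => expSandwich X Y Z x v :=
  (continuous_iff_continuousAt.2 fun x => (hasDerivAt_expSandwich X Y Z x).continuousAt).clm_apply
    continuous_const

theorem expSandwich_apply_eq (X Y Z : V →L[ℂ] V) (R : ℝ) (v : V) :
    expSandwich X Y Z R v = Z v + (X (∫ x in (0 : ℝ)..R, expSandwich X Y Z x v)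
      + ∫ x in (0 : ℝ)..R, expSandwich X Y Z x (Y v)) := by
  have hcont := continuous_expSandwich_apply X Y Z
  have hderiv (x : ℝ) : HasDerivAt (fun x => expSandwich X Y Z x v)
      (X (expSandwich X Y Z x v) + expSandwich X Y Z x (Y v)) x :=
    ((ContinuousLinearMap.apply ℂ V v).restrictScalars ℝ).hasFDerivAt.comp_hasDerivAt x
      (hasDerivAt_expSandwich X Y Z x)
  have hX : Continuous fun x => X (expSandwich X Y Z x v) := X.continuous.comp (hcont v)
  have hftc := intervalIntegral.integral_eq_sub_of_hasDerivAt (a := 0) (b := R)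
    (fun x _ => hderiv x) ((hX.add (hcont (Y v))).intervalIntegrable _ _)
  rw [intervalIntegral.integral_add (hX.intervalIntegrable _ _)
      ((hcont (Y v)).intervalIntegrable _ _),
    ContinuousLinearMap.intervalIntegral_comp_comm _ ((hcont v).intervalIntegrable _ _)] at hftc
  rw [hftc]
  simp [expSandwich, NormedSpace.exp_zero]

theorem sylvester_of_tendsto {X Y Z M : V →L[ℂ] V}
    (hM : ∀ v, Tendsto (fun R : ℝ => ∫ x in (0 : ℝ)..R, expSandwich X Y Z x v) atTop
      (𝓝 (M v))) : X * M + M * Y = -Z := by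
  ext v
  have hlim : Tendsto (fun R => expSandwich X Y Z R v) atTop (𝓝 (Z v + (X (M v) + M (Y v)))) := by
    refine (tendsto_const_nhds.add
      (((X.continuous.tendsto _).comp (hM v)).add (hM (Y v)))).congr fun R => ?_
    exact (expSandwich_apply_eq X Y Z R v).symm
  have hzero := eq_zero_of_tendsto_of_tendsto_intervalIntegral
    (continuous_expSandwich_apply X Y Z v) hlim (hM v)
  exact eq_neg_of_add_eq_zero_right hzero

end Sylvester

section GelfandLevitanMarchenko

variable {H : Type*} [NormedAddCommGroup H] [InnerProductSpace ℂ H] [CompleteSpace H]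
variable {E : Type*} [NormedAddCommGroup E] [InnerProductSpace ℂ E] [CompleteSpace E]
variable {A B ρ N M₁ M C τ : H →L[ℂ] H} {Φ : H →L[ℂ] E} {σB : E →L[ℂ] E}

theorem IsStrongIntegral.tendsto_expSandwich (hM : IsStrongIntegral B ρ M) (f : H) :
    Tendsto (fun R : ℝ => ∫ x in (0 : ℝ)..R, expSandwich (-(Complex.I • adjoint B))
      (Complex.I • B) (ρ * (Complex.I⁻¹ • (B - adjoint B))) x f) atTop (𝓝 (M f)) := by
  refine (hM f).congr fun R => intervalIntegral.integral_congr fun x _ => ?_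
  have hsmul (Y : H →L[ℂ] H) : (Complex.I * (x : ℂ)) • Y = x • Complex.I • Y := by
    rw [mul_comm, ← smul_smul, Complex.coe_smul]
  simp only [expSandwich, neg_smul, smul_neg, hsmul]
  rfl

theorem IsStrongIntegral.lyapunov (hM : IsStrongIntegral B ρ M) :
    Complex.I • (adjoint B * M - M * B) = ρ * (Complex.I⁻¹ • (B - adjoint B)) := by
  have h := sylvester_of_tendsto hM.tendsto_expSandwich
  rw [← neg_inj, ← h]
  simp only [neg_mul, smul_mul_assoc, mul_smul_comm, smul_sub]
  abel

theorem mul_Gam_mul_sub_Gam_mul (hAB : Commute A B) (hA : SemiconjBy M₁ (adjoint A) (-A))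
    (hB : SemiconjBy M₁ (adjoint B) (-B)) (hNB : Commute N B) (hN : N * C = N)
    (hMC : M * C = -M) (x t : ℝ) :
    B * Gam A B N M₁ M x t * C - Gam A B N M₁ M x t * B
      = motion A B (-x) (-t) * (M₁ * (adjoint B * M - M * B)) := by
  have hBT (x t : ℝ) : B * motion A B x t = motion A B x t * B :=
    (semiconjBy_motion hAB.symm (Commute.refl B) x t).eq
  have hBM : B * M₁ = -(M₁ * adjoint B) := by rw [hB.eq, neg_mul, neg_neg]
  rw [Gam_eq hA hB]
  set T := motion A B x t
  set T' := motion A B (-x) (-t)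
  calc B * (T * N + T' * (M₁ * M)) * C - (T * N + T' * (M₁ * M)) * B
      = B * T * (N * C) + B * T' * M₁ * (M * C) - T * (N * B) - T' * M₁ * M * B := by
        noncomm_ring
    _ = -(T' * (B * M₁) * M) - T' * M₁ * M * B := by
        rw [hN, hMC, hNB.eq, hBT, hBT]; noncomm_ring
    _ = T' * (M₁ * (adjoint B * M - M * B)) := by rw [hBM]; noncomm_ring

theorem Gam_apply_soliton_sub (hAB : Commute A B) (hA : SemiconjBy M₁ (adjoint A) (-A))
    (hB : SemiconjBy M₁ (adjoint B) (-B)) (hM : IsStrongIntegral B ρ M) (hNB : Commute N B)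
    (hN : N * C = N) (hMC : M * C = -M) {x t : ℝ} (hG : IsUnit (Gam A B N M₁ M x t)) (g : H) :
    Gam A B N M₁ M x t (soliton A B N M₁ M x t g - Complex.I • B g)
      = motion A B (-x) (-t) (M₁ ((ρ * (Complex.I⁻¹ • (B - adjoint B))) g)) := by
  have hGS : Gam A B N M₁ M x t * soliton A B N M₁ M x t
      = Complex.I • B * Gam A B N M₁ M x t * C := by
    rw [soliton, ← ContinuousLinearMap.mul_def, Ring.mul_inverse_cancel_left _ _ hG,
      ((solvesLinearSystem_Gam hAB hA hB hN hMC).space x t).deriv]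
  have hGS_sub : Gam A B N M₁ M x t * (soliton A B N M₁ M x t - Complex.I • B)
      = motion A B (-x) (-t) * (M₁ * (ρ * (Complex.I⁻¹ • (B - adjoint B)))) := by
    rw [← hM.lyapunov, mul_smul_comm, mul_smul_comm,
      ← mul_Gam_mul_sub_Gam_mul hAB hA hB hNB hN hMC, mul_sub, hGS, smul_sub]
    simp only [smul_mul_assoc, mul_smul_comm]
  exact DFunLike.congr_fun hGS_sub g

theorem motion_neg_mul_Gam (hAB : Commute A B) (hA : SemiconjBy M₁ (adjoint A) (-A))
    (hB : SemiconjBy M₁ (adjoint B) (-B)) (x t : ℝ) :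
    motion A B (-x) (-t) * Gam A B N M₁ M x t
      = N + motion A B (-2 * x) (-2 * t) * (M₁ * M) := by
  rw [Gam_eq hA hB, mul_add, ← mul_assoc, ← mul_assoc, ← motion_add hAB, ← motion_add hAB,
    neg_add_cancel, neg_add_cancel, motion_zero, one_mul, ← neg_add, ← neg_add, ← two_mul,
    ← two_mul, neg_mul, neg_mul]

theorem apply_eq_motion_apply_of_eq_soliton_sub (hAB : Commute A B)
    (hA : SemiconjBy M₁ (adjoint A) (-A)) (hB : SemiconjBy M₁ (adjoint B) (-B))
    (hM : IsStrongIntegral B ρ M) (hNB : Commute N B) (hN : N * C = N) (hMC : M * C = -M)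
    {x t : ℝ} (hG : IsUnit (Gam A B N M₁ M x t)) {g h : H}
    (hh : h = soliton A B N M₁ M x t g - Complex.I • B g) :
    N h = motion A B (-2 * x) (-2 * t)
      (M₁ ((ρ * (Complex.I⁻¹ • (B - adjoint B))) g - M h)) := by
  have hGh := Gam_apply_soliton_sub hAB hA hB hM hNB hN hMC hG g
  rw [← hh] at hGh
  have hTG := DFunLike.congr_fun (motion_neg_mul_Gam (N := N) (M := M) hAB hA hB x t) h
  have hTT : motion A B (-2 * x) (-2 * t) = motion A B (-x) (-t) * motion A B (-x) (-t) := by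
    rw [← motion_add hAB, neg_mul, neg_mul, two_mul, two_mul, neg_add, neg_add]
  rw [map_sub, map_sub, eq_sub_iff_add_eq]
  refine hTG.symm.trans ?_
  rw [mul_apply_eq_comp, hGh, hTT]
  rfl

theorem Psi_apply_mode (hAB : Commute A B)
    (hΦ : Complex.I⁻¹ • (B - adjoint B) = adjoint Φ ∘L σB ∘L Φ)
    (hτ : SemiconjBy τ (adjoint B) (-B)) (y t η : ℝ) (h : H) :
    Psi A B Φ σB (τ * ρ) (y + η) t (mode B Φ h η) =
      (Φ ∘L motion A B y t ∘L τ) (expSandwich (-(Complex.I • adjoint B)) (Complex.I • B)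
        (ρ * (Complex.I⁻¹ • (B - adjoint B))) η h) := by
  have hexp : motion A B η 0 * τ = τ * NormedSpace.exp (η • (-(Complex.I • adjoint B))) := by
    have hsemi := semiconjBy_motion (SemiconjBy.zero_right τ) hτ (-η) 0
    have hsmul : η • (-(Complex.I • adjoint B)) = (Complex.I * ((-η : ℝ) : ℂ)) • adjoint B := by
      rw [mul_comm, ← smul_smul, Complex.coe_smul, smul_neg, neg_smul]
    rw [hsmul, ← motion_time_zero 0, hsemi.eq]
    simp [motion]
  have hT : motion A B (y + η) t = motion A B y t * motion A B η 0 := by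
    rw [← motion_add hAB, add_zero]
  have hop : motion A B (y + η) t * (τ * ρ) * (adjoint Φ ∘L σB ∘L Φ)
        * NormedSpace.exp ((Complex.I * (η : ℂ)) • B)
      = motion A B y t * (τ * expSandwich (-(Complex.I • adjoint B)) (Complex.I • B)
        (ρ * (Complex.I⁻¹ • (B - adjoint B))) η) := by
    rw [← hΦ, hT, expSandwich, mul_comm Complex.I, ← smul_smul, Complex.coe_smul]
    simp only [← mul_assoc]
    rw [mul_assoc (motion A B y t) _ τ, hexp, ← mul_assoc]
  exact congrArg Φ (DFunLike.congr_fun hop h)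

theorem glmEquation_of_eq_motion_apply (hAB : Commute A B)
    (hΦ : Complex.I⁻¹ • (B - adjoint B) = adjoint Φ ∘L σB ∘L Φ)
    (hτ : SemiconjBy τ (adjoint B) (-B)) (hM : IsStrongIntegral B ρ M) {x t : ℝ} {g h k : H}
    (hk : k = motion A B (-2 * x) (-2 * t)
      (τ ((ρ * (Complex.I⁻¹ • (B - adjoint B))) g - M h))) :
    GLMEquation A B Φ σB (τ * ρ) x t k h g := by
  intro ξ
  refine ⟨(Φ ∘L motion A B (-2 * x + ξ) (-2 * t) ∘L τ) (M h), ?_, ?_⟩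
  · refine (((Φ ∘L motion A B (-2 * x + ξ) (-2 * t) ∘L τ).continuous.tendsto _).comp
      (hM.tendsto_expSandwich h)).congr fun R => ?_
    simp only [Psi_apply_mode hAB hΦ hτ]
    exact (ContinuousLinearMap.intervalIntegral_comp_comm _
      ((continuous_expSandwich_apply _ _ _ h).intervalIntegrable _ _)).symm
  · have hPsi := Psi_apply_mode (ρ := ρ) hAB hΦ hτ (-2 * x + ξ) (-2 * t) 0 g
    rw [add_zero] at hPsi
    have hT : motion A B (-2 * x + ξ) (-2 * t)
        = motion A B ξ 0 * motion A B (-2 * x) (-2 * t) := by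
      rw [← motion_add hAB, add_comm ξ, zero_add]
    rw [hPsi, neg_add_eq_sub, ← map_sub, mode, hk, ← motion_time_zero A, hT]
    simp [expSandwich, NormedSpace.exp_zero]

theorem glmEquation_soliton (hAB : A * B = 1) (hBA : B * A = 1)
    (hΦ : Complex.I⁻¹ • (B - adjoint B) = adjoint Φ ∘L σB ∘L Φ)
    (hB : SemiconjBy M₁ (adjoint B) (-B)) (hM : IsStrongIntegral B ρ M) (hNB : Commute N B)
    (hN : N * C = N) (hMC : M * C = -M) {x t : ℝ} (hG : IsUnit (Gam A B N M₁ M x t)) {g h : H}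
    (hh : h = soliton A B N M₁ M x t g - Complex.I • B g) {Q K : H →L[ℂ] H} (hQ : IsUnit Q)
    (hQB : Commute Q B) (hQK : N = Q * K) :
    GLMEquation A B Φ σB (Ring.inverse Q * M₁ * ρ) x t (K h) h g := by
  have hcomm : Commute A B := hAB.trans hBA.symm
  have hQB' : Commute (Ring.inverse Q) B := by
    obtain ⟨q, rfl⟩ := hQ
    rw [Ring.inverse_unit]
    exact hQB.units_inv_left
  have hQA' : Commute (Ring.inverse Q) A := semiconjBy_of_mul_eq_one hQB' hBA hAB
  have hτ : SemiconjBy (Ring.inverse Q * M₁) (adjoint B) (-B) :=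
    SemiconjBy.mul_left hQB'.neg_right hB
  refine glmEquation_of_eq_motion_apply hcomm hΦ hτ hM ?_
  have hNh := apply_eq_motion_apply_of_eq_soliton_sub hcomm (semiconjBy_adjoint_neg hAB hB) hB hM
    hNB hN hMC hG hh
  calc K h = (Ring.inverse Q * N) h := by rw [hQK, Ring.inverse_mul_cancel_left _ _ hQ]
    _ = (Ring.inverse Q * motion A B (-2 * x) (-2 * t))
          (M₁ ((ρ * (Complex.I⁻¹ • (B - adjoint B))) g - M h)) := congrArg _ hNh
    _ = _ := by rw [(semiconjBy_motion hQA' hQB' _ _).eq]; rfl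

end GelfandLevitanMarchenko

section Colligation

variable {H : Type*} [NormedAddCommGroup H] [InnerProductSpace ℂ H] [CompleteSpace H]
  {E : Type*} [NormedAddCommGroup E] [InnerProductSpace ℂ E] [CompleteSpace E]
  {A B : H →L[ℂ] H} {Φ : H →L[ℂ] E} {σA σB γ : E →L[ℂ] E}

theorem sub_star_eq_neg_mul_sub_star_mul {R : Type*} [Ring R] [StarRing R] {a b : R}
    (hab : a * b = 1) : a - star a = -(a * (b - star b) * star a) := by
  have hab' : star b * star a = 1 := by rw [← star_mul, hab, star_one]
  rw [mul_sub, sub_mul, hab, one_mul, mul_assoc, hab', mul_one, neg_sub]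

theorem eq_adjoint_add_I_smul {K : H →L[ℂ] H} (h : Complex.I⁻¹ • (A - adjoint A) = K) :
    A = adjoint A + Complex.I • K := by
  rw [← h, smul_inv_smul₀ Complex.I_ne_zero, add_sub_cancel]

theorem isSelfAdjoint_I_smul_comp_sub_comp (hσA : IsSelfAdjoint σA) (hσB : IsSelfAdjoint σB)
    (Φ : H →L[ℂ] E) : IsSelfAdjoint (Complex.I •
      (σA ∘L Φ ∘L adjoint Φ ∘L σB - σB ∘L Φ ∘L adjoint Φ ∘L σA)) := by
  simp only [isSelfAdjoint_iff', map_smulₛₗ, map_sub, adjoint_comp, adjoint_adjoint,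
    hσA.adjoint_eq, hσB.adjoint_eq, comp_assoc, Complex.conj_I]
  module

theorem isRegularColligation_of_input (hAB : A ∘L B = B ∘L A) (hσA : IsSelfAdjoint σA)
    (hσB : IsSelfAdjoint σB) (hγ : IsSelfAdjoint γ)
    (hA : Complex.I⁻¹ • (A - adjoint A) = adjoint Φ ∘L σA ∘L Φ)
    (hB : Complex.I⁻¹ • (B - adjoint B) = adjoint Φ ∘L σB ∘L Φ)
    (hinput : σA ∘L Φ ∘L adjoint B - σB ∘L Φ ∘L adjoint A = γ ∘L Φ) :
    IsRegularColligation A B Φ σA σB γ (γ + Complex.I •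
      (σA ∘L Φ ∘L adjoint Φ ∘L σB - σB ∘L Φ ∘L adjoint Φ ∘L σA)) where
  comm := hAB
  selfAdjoint_σA := hσA
  selfAdjoint_σB := hσB
  selfAdjoint_γ := hγ
  selfAdjoint_γt := hγ.add (isSelfAdjoint_I_smul_comp_sub_comp hσA hσB Φ)
  im_A := hA
  im_B := hB
  input := hinput
  output := by
    ext1 f
    have hAf := DFunLike.congr_fun (eq_adjoint_add_I_smul hA) f
    have hBf := DFunLike.congr_fun (eq_adjoint_add_I_smul hB) f
    have hin := DFunLike.congr_fun hinput f
    simp only [sub_apply, add_apply, smul_apply, comp_apply] at hAf hBf hin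
    simp only [sub_apply, add_apply, smul_apply, comp_apply, hBf, hAf, map_add, map_smul, ← hin]
    module
  link := add_sub_cancel_left _ _

end Colligation

/-- The row vector `(u, v)`, the elements of the external space `ℂ^{2m}` being pairs of rows of
length `m`. -/
def rowPair {α β : Type} (u : EuclideanSpace ℂ α) (v : EuclideanSpace ℂ β) :
    EuclideanSpace ℂ (α ⊕ β) :=
  WithLp.toLp 2 (Sum.elim u.ofLp v.ofLp)

theorem rowPair_sub {α β : Type} (u u' : EuclideanSpace ℂ α) (v v' : EuclideanSpace ℂ β) :
    rowPair u v - rowPair u' v' = rowPair (u - u') (v - v') := by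
  ext (i | i) <;> rfl

section RowVectors

variable {α β γ : Type} [Fintype α] [Fintype β] [Fintype γ]

theorem rowMul_mul (X : Matrix α β ℂ) (Y : Matrix β γ ℂ) :
    rowMul (X * Y) = rowMul Y ∘L rowMul X := by
  ext1 v
  simp [rowMul_apply, Matrix.vecMul_vecMul]

theorem rowMul_neg (X : Matrix α β ℂ) : rowMul (-X) = -rowMul X := by
  ext1 v
  simp [rowMul_apply, Matrix.vecMul_neg]

theorem rowMul_zero : rowMul (0 : Matrix α β ℂ) = 0 := by
  ext1 v
  simp [rowMul_apply]

theorem adjoint_rowMul (X : Matrix α β ℂ) : adjoint (rowMul X) = rowMul Xᴴ := by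
  refine ((eq_adjoint_iff _ _).2 fun u v => ?_).symm
  simp only [EuclideanSpace.inner_eq_star_dotProduct, rowMul_apply]
  rw [Matrix.star_vecMul, Matrix.conjTranspose_conjTranspose, Matrix.dotProduct_mulVec]

theorem isSelfAdjoint_rowMul {X : Matrix α α ℂ} (hX : X.IsHermitian) :
    IsSelfAdjoint (rowMul X) := by
  rw [isSelfAdjoint_iff', adjoint_rowMul, hX.eq]

theorem inner_rowPair (u u' : EuclideanSpace ℂ α) (v v' : EuclideanSpace ℂ β) :
    ⟪rowPair u v, rowPair u' v'⟫_ℂ = ⟪u, u'⟫_ℂ + ⟪v, v'⟫_ℂ := by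
  simp [rowPair, PiLp.inner_apply]

theorem rowMul_fromBlocks_rowPair (X : Matrix α α ℂ) (Y : Matrix α β ℂ) (Z : Matrix β α ℂ)
    (W : Matrix β β ℂ) (u : EuclideanSpace ℂ α) (v : EuclideanSpace ℂ β) :
    rowMul (Matrix.fromBlocks X Y Z W) (rowPair u v) =
      rowPair (rowMul X u + rowMul Z v) (rowMul Y u + rowMul W v) := by
  simp only [rowMul_apply, rowPair, Matrix.vecMul_fromBlocks]
  rfl

end RowVectors

section Fubini

variable {α 𝕜 F : Type*} [MeasurableSpace α] {μ : Measure α} [RCLike 𝕜]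
  [NormedAddCommGroup F] [InnerProductSpace 𝕜 F] {u v : α → F}

theorem integral_inner_const [CompleteSpace F] [NormedSpace ℝ F] (hu : Integrable u μ) (c : F) :
    ∫ x, ⟪u x, c⟫_𝕜 ∂μ = ⟪∫ x, u x ∂μ, c⟫_𝕜 := by
  rw [← inner_conj_symm, ← integral_inner hu, ← integral_conj]
  simp only [inner_conj_symm]

theorem integrable_inner_prod [SFinite μ] (hu : Integrable u μ) (hv : Integrable v μ) :
    Integrable (fun z : α × α => ⟪u z.2, v z.1⟫_𝕜) (μ.prod μ) := by
  refine (hu.norm.mul_prod hv.norm).swap.mono'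
    (hu.aestronglyMeasurable.comp_snd.inner hv.aestronglyMeasurable.comp_fst)
    (.of_forall fun z => norm_inner_le_norm _ _)

theorem integral_inner_setIntegral_Iio [CompleteSpace F] [NormedSpace ℝ F] [SFinite μ]
    [LinearOrder α] [TopologicalSpace α] [OrderClosedTopology α] [SecondCountableTopology α]
    [OpensMeasurableSpace α] (hu : Integrable u μ) (hv : Integrable v μ) :
    ∫ w, ⟪∫ ξ in Set.Iio w, u ξ ∂μ, v w⟫_𝕜 ∂μ = ∫ ξ, ⟪u ξ, ∫ w in Set.Ioi ξ, v w ∂μ⟫_𝕜 ∂μ := by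
  let k (w ξ : α) : 𝕜 := {z : α × α | z.2 < z.1}.indicator (fun z => ⟪u z.2, v z.1⟫_𝕜) (w, ξ)
  have integral_k_right (w : α) : ∫ ξ, k w ξ ∂μ = ⟪∫ ξ in Set.Iio w, u ξ ∂μ, v w⟫_𝕜 := by
    rw [← integral_inner_const hu.integrableOn, ← integral_indicator measurableSet_Iio]
    rfl
  have integral_k_left (ξ : α) : ∫ w, k w ξ ∂μ = ⟪u ξ, ∫ w in Set.Ioi ξ, v w ∂μ⟫_𝕜 := by
    rw [← integral_inner hv.integrableOn, ← integral_indicator measurableSet_Ioi]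
    rfl
  simp only [← integral_k_right, ← integral_k_left]
  exact integral_integral_swap ((integrable_inner_prod hu hv).indicator
    (measurableSet_lt measurable_snd measurable_fst))

end Fubini

section TriangularModel

variable {l d : ℝ} {p r s : ℕ}

theorem Delta_subset_Icc (hld : -l ≤ d) : Delta l d ⊆ Set.Icc (-l) l :=
  Set.union_subset (Set.Icc_subset_Icc_right (by linarith)) (Set.Icc_subset_Icc_left hld)

theorem coeFn_mulVar (f : HSpace l d p) :
    mulVar l d p f =ᵐ[muDelta l d] fun w => (w : ℂ) • f w := (memLp_mulFun f).coeFn_toLp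

theorem adjoint_mulVar : adjoint (mulVar l d p) = mulVar l d p := by
  refine ((eq_adjoint_iff _ _).2 fun f g => ?_).symm
  rw [L2.inner_def, L2.inner_def]
  refine integral_congr_ae ?_
  filter_upwards [coeFn_mulVar f, coeFn_mulVar g] with w hf hg
  rw [hf, hg, inner_smul_left, inner_smul_right, Complex.conj_ofReal]

namespace ModelData

variable (D : ModelData l d p r s)

theorem channel_of_notMem (f : HSpace l d p) {ξ : ℝ} (hξ : ξ ∉ Delta l d) : D.channel f ξ = 0 :=
  Set.indicator_of_notMem hξ _

theorem Phi_apply (f : HSpace l d p) : D.Phi f = ∫ w, D.channel f w := rfl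

theorem intervalIntegral_channel_left (hld : -l ≤ d) (f : HSpace l d p) (w : ℝ) :
    ∫ ξ in (-l)..w, D.channel f ξ = ∫ ξ in Set.Iio w, D.channel f ξ := by
  have hi := D.integrable_channel f
  have integral_Iio_eq_zero : ∫ ξ in Set.Iio (-l), D.channel f ξ = 0 :=
    setIntegral_eq_zero_of_forall_eq_zero fun ξ hξ =>
      D.channel_of_notMem f fun h => (Delta_subset_Icc hld h).1.not_gt hξ
  rw [← intervalIntegral.integral_Iic_sub_Iic hi.integrableOn hi.integrableOn,
    integral_Iic_eq_integral_Iio, integral_Iic_eq_integral_Iio, integral_Iio_eq_zero, sub_zero]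

theorem intervalIntegral_channel_right (hld : -l ≤ d) (f : HSpace l d p) (w : ℝ) :
    ∫ ξ in w..l, D.channel f ξ = ∫ ξ in Set.Ioi w, D.channel f ξ := by
  have hi := D.integrable_channel f
  have integral_Ioi_eq_zero : ∫ ξ in Set.Ioi l, D.channel f ξ = 0 :=
    setIntegral_eq_zero_of_forall_eq_zero fun ξ hξ =>
      D.channel_of_notMem f fun h => (Delta_subset_Icc hld h).2.not_gt hξ
  rw [← intervalIntegral.integral_interval_add_Ioi hi.integrableOn hi.integrableOn (b := l),
    integral_Ioi_eq_zero, add_zero]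

theorem intervalIntegral_channel_eq_Phi (hld : -l ≤ d) (f : HSpace l d p) :
    ∫ ξ in (-l)..l, D.channel f ξ = D.Phi f := by
  rw [D.intervalIntegral_channel_left hld, ← integral_Iic_eq_integral_Iio, Phi_apply]
  exact setIntegral_eq_integral_of_forall_compl_eq_zero fun ξ hξ =>
    D.channel_of_notMem f fun h => hξ (Delta_subset_Icc hld h).2

theorem integrable_rowMul_channel (C : Matrix (Fin r ⊕ Fin s) (Fin r ⊕ Fin s) ℂ)
    (f : HSpace l d p) : Integrable fun w => rowMul C (D.channel f w) :=
  (rowMul C).integrable_comp (D.integrable_channel f)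

section Volterra

variable {a b c : ℝ → ℝ} (ha : Continuous a) (hb : Continuous b) (hc : Continuous c)
  (C : Matrix (Fin r ⊕ Fin s) (Fin r ⊕ Fin s) ℂ)

theorem coeFn_volterra (f : HSpace l d p) :
    D.volterra a b ha hb C f =ᵐ[muDelta l d] D.volterraFun a b C f :=
  (D.memLp_volterraFun ha hb C f).coeFn_toLp

theorem inner_volterra (f g : HSpace l d p) :
    ⟪g, D.volterra a b ha hb C f⟫_ℂ =
      ∫ w, ⟪rowMul Cᴴ (D.channel g w), ∫ ξ in (a w)..(b w), D.channel f ξ⟫_ℂ := by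
  have inner_apply_ae : ∀ᵐ w ∂muDelta l d, ⟪g w, D.volterra a b ha hb C f w⟫_ℂ =
      ⟪rowMul Cᴴ (rowMul (D.P w) (g w)), ∫ ξ in (a w)..(b w), D.channel f ξ⟫_ℂ := by
    filter_upwards [D.coeFn_volterra ha hb C f] with w hw
    rw [hw, volterraFun, rowMul_mul, ← adjoint_rowMul, ← adjoint_rowMul, adjoint_inner_left,
      comp_apply, adjoint_inner_right]
  rw [L2.inner_def, integral_congr_ae inner_apply_ae]
  refine (integral_indicator (measurableSet_Delta l d)).symm.trans ?_
  congr 1 with w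
  by_cases hw : w ∈ Delta l d <;> simp [channel, hw]

theorem volterra_add_volterra :
    D.volterra a b ha hb C + D.volterra b c hb hc C = D.volterra a c ha hc C := by
  ext1 f
  refine Lp.ext ?_
  have hi (x y : ℝ) : IntervalIntegrable (D.channel f) volume x y :=
    (D.integrable_channel f).intervalIntegrable
  filter_upwards [Lp.coeFn_add (D.volterra a b ha hb C f) (D.volterra b c hb hc C f),
    D.coeFn_volterra ha hb C f, D.coeFn_volterra hb hc C f, D.coeFn_volterra ha hc C f]
    with w hadd hab hbc hac
  rw [add_apply, hadd, Pi.add_apply, hab, hbc, hac, volterraFun, volterraFun, volterraFun,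
    ← map_add, intervalIntegral.integral_add_adjacent_intervals (hi _ _) (hi _ _)]

/-- The Volterra operator `f ↦ (∫_{-l}^w f Π) C Π*(w)`. -/
abbrev volterraLeft : HSpace l d p →L[ℂ] HSpace l d p :=
  D.volterra (fun _ => -l) (fun w => w) continuous_const continuous_id' C

/-- The Volterra operator `f ↦ (∫_w^l f Π) C Π*(w)`. -/
abbrev volterraRight : HSpace l d p →L[ℂ] HSpace l d p :=
  D.volterra (fun w => w) (fun _ => l) continuous_id' continuous_const C

theorem adjoint_volterraRight (hld : -l ≤ d) :
    adjoint (D.volterraRight C) = D.volterraLeft Cᴴ := by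
  refine ((eq_adjoint_iff _ _).2 fun f g => ?_).symm
  rw [← inner_conj_symm, D.inner_volterra, D.inner_volterra, ← integral_conj]
  simp only [inner_conj_symm, D.intervalIntegral_channel_left hld,
    D.intervalIntegral_channel_right hld, Matrix.conjTranspose_conjTranspose]
  rw [← integral_inner_setIntegral_Iio (D.integrable_rowMul_channel _ _)
    (D.integrable_channel _)]
  congr 1 with w
  rw [(rowMul Cᴴ).integral_comp_comm (D.integrable_channel f).integrableOn, ← adjoint_rowMul,
    adjoint_inner_left]

theorem adjoint_volterraLeft (hld : -l ≤ d) :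
    adjoint (D.volterraLeft C) = D.volterraRight Cᴴ := by
  rw [← adjoint_adjoint (D.volterraRight Cᴴ), D.adjoint_volterraRight _ hld,
    Matrix.conjTranspose_conjTranspose]

theorem volterraLeft_add_volterraRight (hld : -l ≤ d) :
    D.volterraLeft C + D.volterraRight C = adjoint D.Phi ∘L rowMul C ∘L D.Phi := by
  rw [D.volterra_add_volterra]
  ext1 f
  refine ext_inner_left ℂ fun g => ?_
  simp only [D.inner_volterra, D.intervalIntegral_channel_eq_Phi hld]
  rw [integral_inner_const (D.integrable_rowMul_channel _ g),
    (rowMul Cᴴ).integral_comp_comm (D.integrable_channel g), ← Phi_apply, ← adjoint_rowMul,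
    adjoint_inner_left, comp_apply, adjoint_inner_right, comp_apply]

end Volterra

theorem isHermitian_L : D.L.IsHermitian := by
  simp only [Matrix.IsHermitian, L, J₁, J₂, S, Matrix.conjTranspose_add,
    Matrix.conjTranspose_sub, Matrix.fromBlocks_conjTranspose, Matrix.conjTranspose_zero,
    Matrix.conjTranspose_one, Matrix.conjTranspose_conjTranspose]
  abel

theorem B_sub_adjoint_B (hld : -l ≤ d) :
    D.B - adjoint D.B = Complex.I • (adjoint D.Phi ∘L rowMul D.L ∘L D.Phi) := by
  have hL := D.adjoint_volterraLeft D.L hld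
  have hS := D.adjoint_volterraLeft D.Sᴴ hld
  have hS' := D.adjoint_volterraRight D.S hld
  rw [D.isHermitian_L.eq] at hL
  rw [Matrix.conjTranspose_conjTranspose] at hS
  rw [← D.volterraLeft_add_volterraRight _ hld, B]
  simp only [map_add, map_sub, map_smulₛₗ, adjoint_mulVar, hL, hS, hS', Complex.conj_I]
  module

theorem PhiT_apply (f : HSpace l d p) :
    D.PhiT f = rowPair (D.Phi f) (D.Phi (adjoint D.A f)) := by
  ext (i | i) <;> rfl

section Signatures

variable (u v : EuclideanSpace ℂ (Fin r ⊕ Fin s))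

theorem sigmaA_rowPair : D.sigmaA (rowPair u v) = rowPair 0 (-rowMul D.L v) := by
  simp [sigmaA, rowMul_fromBlocks_rowPair, rowMul_zero, rowMul_neg]

theorem sigmaB_rowPair : D.sigmaB (rowPair u v) = rowPair (rowMul D.L u) 0 := by
  simp [sigmaB, rowMul_fromBlocks_rowPair, rowMul_zero]

theorem gamma_rowPair : D.gamma (rowPair u v) = rowPair (-rowMul D.L v) (-rowMul D.L u) := by
  simp [gamma, rowMul_fromBlocks_rowPair, rowMul_zero, rowMul_neg]

end Signatures

theorem isSelfAdjoint_sigmaA : IsSelfAdjoint D.sigmaA :=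
  isSelfAdjoint_rowMul (Matrix.isHermitian_zero.fromBlocks (by simp) D.isHermitian_L.neg)

theorem isSelfAdjoint_sigmaB : IsSelfAdjoint D.sigmaB :=
  isSelfAdjoint_rowMul (D.isHermitian_L.fromBlocks (by simp) Matrix.isHermitian_zero)

theorem isSelfAdjoint_gamma : IsSelfAdjoint D.gamma :=
  isSelfAdjoint_rowMul (Matrix.isHermitian_zero.fromBlocks D.isHermitian_L.neg
    Matrix.isHermitian_zero)

theorem adjoint_PhiT_comp_sigmaB_comp_PhiT :
    adjoint D.PhiT ∘L D.sigmaB ∘L D.PhiT = adjoint D.Phi ∘L rowMul D.L ∘L D.Phi := by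
  ext1 f
  refine ext_inner_left ℂ fun g => ?_
  simp only [comp_apply, adjoint_inner_right, PhiT_apply, sigmaB_rowPair, inner_rowPair,
    inner_zero_right, add_zero]

theorem adjoint_PhiT_comp_sigmaA_comp_PhiT :
    adjoint D.PhiT ∘L D.sigmaA ∘L D.PhiT =
      -(D.A ∘L (adjoint D.Phi ∘L rowMul D.L ∘L D.Phi) ∘L adjoint D.A) := by
  ext1 f
  refine ext_inner_left ℂ fun g => ?_
  simp only [comp_apply, neg_apply, inner_neg_right, adjoint_inner_right, PhiT_apply,
    sigmaA_rowPair, inner_rowPair, inner_zero_right, zero_add]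
  rw [← adjoint_inner_left D.A, adjoint_inner_right D.Phi]

theorem im_B (hld : -l ≤ d) :
    Complex.I⁻¹ • (D.B - adjoint D.B) = adjoint D.PhiT ∘L D.sigmaB ∘L D.PhiT := by
  rw [D.B_sub_adjoint_B hld, inv_smul_smul₀ Complex.I_ne_zero,
    D.adjoint_PhiT_comp_sigmaB_comp_PhiT]

variable {D}

theorem A_mul_B (hB : IsUnit D.B) : D.A * D.B = 1 := Ring.inverse_mul_cancel _ hB

theorem B_mul_A (hB : IsUnit D.B) : D.B * D.A = 1 := Ring.mul_inverse_cancel _ hB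

theorem im_A (hld : -l ≤ d) (hB : IsUnit D.B) :
    Complex.I⁻¹ • (D.A - adjoint D.A) = adjoint D.PhiT ∘L D.sigmaA ∘L D.PhiT := by
  have A_sub_adjoint_A : D.A - adjoint D.A = -(D.A * (D.B - adjoint D.B) * adjoint D.A) :=
    sub_star_eq_neg_mul_sub_star_mul (A_mul_B hB)
  rw [A_sub_adjoint_A, D.B_sub_adjoint_B hld, D.adjoint_PhiT_comp_sigmaA_comp_PhiT,
    mul_smul_comm, smul_mul_assoc, smul_neg, inv_smul_smul₀ Complex.I_ne_zero, mul_assoc]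
  rfl

theorem sigmaA_comp_PhiT_comp_adjoint_B_sub (hB : IsUnit D.B) :
    D.sigmaA ∘L D.PhiT ∘L adjoint D.B - D.sigmaB ∘L D.PhiT ∘L adjoint D.A =
      D.gamma ∘L D.PhiT := by
  have adjoint_A_mul_adjoint_B : adjoint D.A * adjoint D.B = 1 := by
    rw [← star_eq_adjoint, ← star_eq_adjoint, ← star_mul, B_mul_A hB, star_one]
  ext1 f
  have h : adjoint D.A (adjoint D.B f) = f := DFunLike.congr_fun adjoint_A_mul_adjoint_B f
  simp only [sub_apply, comp_apply, PhiT_apply, sigmaA_rowPair, sigmaB_rowPair, gamma_rowPair,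
    rowPair_sub, h, zero_sub, sub_zero]

theorem isRegularColligation (hld : -l ≤ d) (hB : IsUnit D.B) :
    IsRegularColligation D.A D.B D.PhiT D.sigmaA D.sigmaB D.gamma D.gammaT :=
  isRegularColligation_of_input ((A_mul_B hB).trans (B_mul_A hB).symm) D.isSelfAdjoint_sigmaA
    D.isSelfAdjoint_sigmaB D.isSelfAdjoint_gamma (im_A hld hB) (D.im_B hld)
    (sigmaA_comp_PhiT_comp_adjoint_B_sub hB)

end ModelData

end TriangularModel

end SolitonGLM

end

open SolitonGLM in
theorem mainTheorem5_general {l d : ℝ} (hld : -l ≤ d) {p r s : ℕ} (D : ModelData l d p r s)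
    (hB : IsUnit D.B) (ρ N M₁ M Bt : HSpace l d p →L[ℂ] HSpace l d p)
    (hM₁ : M₁ ∘L adjoint D.B = -(D.B ∘L M₁)) (hM : IsStrongIntegral D.B ρ M)
    (hNB : N ∘L D.B = D.B ∘L N) (hN : N ∘L Bt = N) (hMB : M ∘L Bt = -M) (hBt : Bt ∘L Bt = 1) :
    IsRegularColligation D.A D.B D.PhiT D.sigmaA D.sigmaB D.gamma D.gammaT ∧
    ∀ x t : ℝ, IsUnit (Gam D.A D.B N M₁ M x t) →
      SineGordonAt Bt (soliton D.A D.B N M₁ M) x t ∧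
      ∀ g h, h = soliton D.A D.B N M₁ M x t g - Complex.I • D.B g →
        GLMEquation D.A D.B D.PhiT D.sigmaB (M₁ ∘L ρ) x t (N h) h g ∧
        (N = P₁ Bt → GLMEquation D.A D.B D.PhiT D.sigmaB (M₁ ∘L ρ) x t (P₁ Bt h) h g) ∧
        (∀ Nhat : HSpace l d p →L[ℂ] HSpace l d p, IsUnit Nhat →
          Nhat ∘L D.B = D.B ∘L Nhat → N = Nhat ∘L P₁ Bt →
          GLMEquation D.A D.B D.PhiT D.sigmaB (Ring.inverse Nhat ∘L M₁ ∘L ρ) x t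
            (P₁ Bt h) h g) := by
  have hAB := ModelData.A_mul_B hB
  have hBA := ModelData.B_mul_A hB
  have hsemi : SemiconjBy M₁ (adjoint D.B) (-D.B) := hM₁.trans (neg_mul _ _).symm
  refine ⟨D.isRegularColligation hld hB, fun x t hG =>
    ⟨sineGordonAt_soliton hAB hBA hsemi hN hMB hBt hG, fun g h hh => ?_⟩⟩
  have glm_of_factor {Q K : HSpace l d p →L[ℂ] HSpace l d p} (hQ : IsUnit Q)
      (hQB : Commute Q D.B) (hQK : N = Q * K) :
      GLMEquation D.A D.B D.PhiT D.sigmaB (Ring.inverse Q * M₁ * ρ) x t (K h) h g :=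
    glmEquation_soliton hAB hBA (D.im_B hld) hsemi hM hNB hN hMB hG hh hQ hQB hQK
  have glm_N : GLMEquation D.A D.B D.PhiT D.sigmaB (M₁ * ρ) x t (N h) h g := by
    simpa using glm_of_factor isUnit_one (Commute.one_left _) (one_mul N).symm
  exact ⟨glm_N, fun hNP => hNP ▸ glm_N, fun Nhat hQ hQB hQK => glm_of_factor hQ hQB hQK⟩

theorem mainTheorem5 {l d : ℝ} (hd : 0 < d) (hdl : d < l) {p r s : ℕ}
    (D : SolitonGLM.ModelData l d p r s) (hB : IsUnit D.B)
    (U : SolitonGLM.HSpace l d p →L[ℂ] SolitonGLM.HSpace l d p)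
    (hU : adjoint U ∘L U = 1) (hU' : U ∘L adjoint U = 1)
    (hBU : adjoint D.B = -(U ∘L D.B ∘L adjoint U))
    (ρ N M₁ M Bt : SolitonGLM.HSpace l d p →L[ℂ] SolitonGLM.HSpace l d p)
    (hM₁ : M₁ = adjoint U) (hM : SolitonGLM.IsStrongIntegral D.B ρ M)
    (hNB : N ∘L D.B = D.B ∘L N) (hN : N ∘L Bt = N) (hMB : M ∘L Bt = -M)
    (hBt : Bt ∘L Bt = 1) :
    SolitonGLM.IsRegularColligation D.A D.B D.PhiT D.sigmaA D.sigmaB D.gamma D.gammaT ∧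
    ∀ x t : ℝ, IsUnit (SolitonGLM.Gam D.A D.B N M₁ M x t) →
      SolitonGLM.SineGordonAt Bt (SolitonGLM.soliton D.A D.B N M₁ M) x t ∧
      ∀ g ∈ LinearMap.range (D.B - adjoint D.B).toLinearMap, ∀ h,
        h = SolitonGLM.soliton D.A D.B N M₁ M x t g - Complex.I • D.B g →
        SolitonGLM.GLMEquation D.A D.B D.PhiT D.sigmaB (adjoint U ∘L ρ) x t (N h) h g ∧
        (N = SolitonGLM.P₁ Bt →
          SolitonGLM.GLMEquation D.A D.B D.PhiT D.sigmaB (adjoint U ∘L ρ) x t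
            (SolitonGLM.P₁ Bt h) h g) ∧
        (∀ Nhat : SolitonGLM.HSpace l d p →L[ℂ] SolitonGLM.HSpace l d p, IsUnit Nhat →
          Nhat ∘L D.B = D.B ∘L Nhat → N = Nhat ∘L SolitonGLM.P₁ Bt →
          SolitonGLM.GLMEquation D.A D.B D.PhiT D.sigmaB
            (Ring.inverse Nhat ∘L adjoint U ∘L ρ) x t (SolitonGLM.P₁ Bt h) h g) := by
  have adjoint_U_mul_adjoint_B : adjoint U * adjoint D.B = -(D.B * adjoint U) := by
    rw [hBU, ← mul_def, ← mul_def, mul_neg, ← mul_assoc, mul_def (adjoint U), hU, one_mul]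
  subst hM₁
  obtain ⟨hcol, hsol⟩ := mainTheorem5_general (by linarith) D hB ρ N _ M Bt
    adjoint_U_mul_adjoint_B hM hNB hN hMB hBt
  exact ⟨hcol, fun x t hG => ⟨(hsol x t hG).1, fun g _ => (hsol x t hG).2 g⟩⟩
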